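/- **Setting.** Let $a_0,a_1,\kappa>0$ be fixed (absolute) constants. Let $X=(x_j)_{j=1}^d$ be a random vector in $\mathbb{R}^d$ and let $\xi$ be a real random variable on the same probability space (not necessarily independent of $X$); e.g. $\xi=Y-f^*(X)$. Let $N\le d$, $t\ge 4$, $L\in\mathbb{R}$, $q>2$, put $p_0=t\log d$ and assume that * $p_0\le \kappa N$; * for every $1\le j\le d$ and every real $2\le p\le p_0$, $x_j\in L_p$ and $\|x_j\|_{L_p}\le L\sqrt p\,\|x_j\|_{L_2}$; * $\xi\in L_q$; * with $r=\min\{1/2+q/4,\,2\}$ and $r'$ its conjugate index, $4r'\max\{2,\,1+a_0/a_1\}\le t\log N$. Let $(X_i,\xi_i)_{i=1}^N$ be independent copies of $(X,\xi)$, let $X_i(j)$ be the $j$-th coordinate of $X_i$, and let $\varepsilon_1,\dots,\varepsilon_N$ be independent, symmetric, $\{-1,1\}$-valued random variables that are independent of $(X_i,\xi_i)_{i=1}^N$. **Theorem.** There are constants $c_0,c_1,c_2>0$ that depend only on the fixed constants $a_0,a_1,\kappa$, and a constant $c_3(q)>0$ that depends only on $q$ and these fixed constants, such that in the above setting the following holds.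 First, $\max_{1\le j\le d}\big|N^{-1/2}\sum_{i=1}^N\varepsilon_iX_i(j)\big|$ is integrable and $$ \mathbb{E}\max_{1\le j\le d}\Big|\frac1{\sqrt N}\sum_{i=1}^N\varepsilon_iX_i(j)\Big|\le c_0\sqrt{\log d}\cdot L\max_{1\le j\le d}\|x_j\|_{L_2}. $$ Second, for every $u>2$, $v>0$, $w\ge2$, and for $p=p_0/2$ and $m=p/\log(eN/p)$ (read as $m=0$ if $p=eN$), with probability at least $$ 1-\frac{\exp(-p/2)}{u^{2p}}-\frac{4\exp(-p/2)}{u^{c_1m}}-\frac{c_2\log^qN}{w^qN^{q/2-1}}-2\exp(-v^2t\log d) $$ one has $$ \max_{1\le j\le d}\Big|\sum_{i=1}^N\varepsilon_i\xi_iX_i(j)\Big|\le c_3(q)\,(uw+u^2v)\,L\,\|\xi\|_{L_q}\sqrt N\,\sqrt{t\log d}\,\max_{1\le j\le d}\|x_j\|_{L_2}. $$ -/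

import Mathlib

open MeasureTheory ProbabilityTheory

/-- The law of a symmetric `{-1, 1}`-valued random variable. -/
noncomputable def signLaw : Measure ℝ :=
  (2⁻¹ : ENNReal) • Measure.dirac (1 : ℝ) + (2⁻¹ : ENNReal) • Measure.dirac (-1 : ℝ)

/-- The norm `‖Z‖_{L_p} = (𝔼 |Z|^p)^{1/p}` for a real exponent `p > 0`. It is only used for
random variables that are known to belong to `L_p`. -/
noncomputable def normL {Ω : Type*} [MeasurableSpace Ω] (P : Measure Ω) (p : ℝ) (Z : Ω → ℝ) : ℝ :=
  lpNorm Z (ENNReal.ofReal p) P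

/-- `max_j ‖x_j‖_{L_2}`, where `x_1, …, x_d` are the coordinates of the random vector `X`. -/
noncomputable def maxNormL2 {Ω : Type*} [MeasurableSpace Ω] (P : Measure Ω) {d : ℕ}
    (X : Ω → Fin d → ℝ) : ℝ :=
  ⨆ j : Fin d, normL P 2 (fun ω => X ω j)

/-- The index `r = min {1/2 + q/4, 2}`. -/
noncomputable def indexR (q : ℝ) : ℝ := min (1 / 2 + q / 4) 2

/-- The conjugate index `r'` of `r = min {1/2 + q/4, 2}`, i.e. `1/r + 1/r' = 1`. -/
noncomputable def indexR' (q : ℝ) : ℝ := Real.conjExponent (indexR q)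

/-- The limited moment assumption on a random vector `X = (x_1, …, x_d)` and a random variable `ξ`
defined on the same probability space, for the sample size `N`, with `p₀ = t log d`. Here `κ` is
the constant in `p₀ ≲ N`. -/
structure LimitedMoments {Ω : Type*} [MeasurableSpace Ω] (P : Measure Ω) (a₀ a₁ κ : ℝ)
    (N d : ℕ) (t L q : ℝ) (X : Ω → Fin d → ℝ) (ξ : Ω → ℝ) : Prop where
  card_le : N ≤ d
  four_le : 4 ≤ t
  order_le : t * Real.log d ≤ κ * N
  moments : ∀ j : Fin d, ∀ p : ℝ, 2 ≤ p → p ≤ t * Real.log d →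
    MemLp (fun ω => X ω j) (ENNReal.ofReal p) P ∧
      normL P p (fun ω => X ω j) ≤ L * √p * normL P 2 (fun ω => X ω j)
  two_lt : 2 < q
  noise : MemLp ξ (ENNReal.ofReal q) P
  index_le : 4 * indexR' q * max 2 (1 + a₀ / a₁) ≤ t * Real.log N

/-- `(Xᵢ, ξᵢ)`, `i = 1, …, N`, are independent copies of the pair `(X₀, ξ₀)` (where `ξ₀` need not
be independent of `X₀`), and `ε₁, …, ε_N` are independent symmetric signs that are independent of
`(Xᵢ, ξᵢ)`, `i = 1, …, N`. -/
structure SignedSample {Ω₀ Ω : Type*} [MeasurableSpace Ω₀] [MeasurableSpace Ω]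
    (P₀ : Measure Ω₀) (P : Measure Ω) {N d : ℕ}
    (X₀ : Ω₀ → Fin d → ℝ) (ξ₀ : Ω₀ → ℝ)
    (X : Fin N → Ω → Fin d → ℝ) (ξ ε : Fin N → Ω → ℝ) : Prop where
  copies : ∀ i, IdentDistrib (fun ω => (X i ω, ξ i ω)) (fun ω => (X₀ ω, ξ₀ ω)) P P₀
  indep_copies : iIndepFun (fun i ω => (X i ω, ξ i ω)) P
  signs : ∀ i, P.map (ε i) = signLaw
  indep_signs : iIndepFun ε P
  indep : IndepFun (fun ω i => ε i ω) (fun ω i => (X i ω, ξ i ω)) P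

/-! After rescaling, the sample lives on the product of the sign laws with `n` copies of a law `ν`,
and each coordinate satisfies `‖x_j‖_a ≤ √a` for `2 ≤ a ≤ 2p`, with `2p = t log d`, while the noise
`g` satisfies `‖g‖_q ≤ 1`. Orders up to a multiple of `log d` suffice, because every union bound
runs over only `d ≤ e^(p/2)` coordinates.

Expectation bound. Conditionally on the sample, a sign sum is sub-Gaussian with variance proxy `V_j
= n⁻¹ ∑ x_j(z_i)²`. A deterministic inequality (`abs_le_exp_add_sq`) replaces the maximum over `j`
by a sum of exponentials of integral at most one, plus a multiple of `V_j`. The latter is controlled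
through its moment of order `k ≈ log d`: that moment is bounded by `C^k`, and a factor `e^k ≥ d`
pays for the sum over `j`.

Deviation bound. For each `j` the sample points are split according to whether `|x_j|` or `|g|`
exceeds a truncation level. On the typical points, Hoeffding's inequality reduces the sum to `∑ (g
x_j)²`, which Hölder with the indices `r, r'` splits into truncated empirical moments of orders `2r
< q` and `2r'`. Truncated summands are bounded, so a Chernoff bound (`measure_truncated_moment_le`)
gives tails of order `u^(-cp)`, strong enough for the union bound. On the atypical points,
Cauchy–Schwarz suffices without any cancellation: `∑ g²` is of order `w² n` by truncation at `w √n /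
log n`, and the squares of `x_j` over the atypical points sum only to order `u² p`, because the
atypical set has small measure (`measure_sum_indicator_sq_le`). Either way the result is of order
`√n √p`.

Both moment estimates for sums rest on `∑ W_i / D ≤ ∏ (1 + W_i / D)`: by independence, the `k`-th
moment reduces to one binomial expansion, where the growth `s^s` of the moments is compensated by
the binomial coefficients. -/

/-! ### Chernoff bounds for truncated empirical moments -/

theorem measure_le_ofReal_div {α : Type*} [MeasurableSpace α] {μ : Measure α} {F : α → ℝ}
    (hF : Measurable F) {S : Set α} {B I : ℝ} (hB : 0 < B) (hS : ∀ x ∈ S, B ≤ F x)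
    (hI : ∫⁻ x, ENNReal.ofReal (F x) ∂μ ≤ ENNReal.ofReal I) :
    μ S ≤ ENNReal.ofReal (I / B) := by
  have h1 : S ⊆ {x | ENNReal.ofReal B ≤ ENNReal.ofReal (F x)} := fun x hx =>
    ENNReal.ofReal_le_ofReal (hS x hx)
  refine (measure_mono h1).trans ((meas_ge_le_lintegral_div (by fun_prop) ?_ (by simp)).trans ?_)
  · simpa using hB
  · rw [ENNReal.ofReal_div_of_pos hB]
    gcongr

theorem lintegral_pi_prod_eq {α : Type*} [MeasurableSpace α] {n : ℕ} (ν : Measure α)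
    [IsProbabilityMeasure ν] (f : Fin n → α → ENNReal) (hf : ∀ i, Measurable (f i)) :
    ∫⁻ z, ∏ i, f i (z i) ∂(Measure.pi fun _ : Fin n => ν) = ∏ i, ∫⁻ a, f i a ∂ν := by
  have h := lintegral_prod_eq_prod_lintegral_of_indepFun Finset.univ
    (fun i (z : Fin n → α) => f i (z i))
    (iIndepFun_pi (μ := fun _ : Fin n => ν) (X := f) fun i => (hf i).aemeasurable)
    (fun i => (hf i).comp (measurable_pi_apply i))
  rw [h]
  refine Finset.prod_congr rfl fun i _ => ?_
  exact (measurePreserving_eval (fun _ : Fin n => ν) i).lintegral_comp (hf i)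

/-- Bernoulli's inequality. It linearises `b ^ Y` for `Y ∈ [0, 1]`, so that only the mean of `Y`
enters the Chernoff bound. -/
theorem rpow_le_one_add_mul {b y : ℝ} (hb : 1 ≤ b) (h0 : 0 ≤ y) (h1 : y ≤ 1) :
    b ^ y ≤ 1 + b * y := by
  have := rpow_one_add_le_one_add_mul_self (s := b - 1) (by linarith) h0 h1
  rw [add_sub_cancel] at this
  nlinarith

/-- A Chernoff bound for sums of independent copies of a `[0, 1]`-valued function. -/
theorem measure_sum_ge_le_of_mem_Icc {α : Type*} [MeasurableSpace α] {n : ℕ} (ν : Measure α)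
    [IsProbabilityMeasure ν] {Y : α → ℝ} (hY : Measurable Y) (h0 : ∀ x, 0 ≤ Y x)
    (h1 : ∀ x, Y x ≤ 1) {μ b A : ℝ} (hμ : 0 ≤ μ) (hb : 1 ≤ b)
    (hm : ∫⁻ x, ENNReal.ofReal (Y x) ∂ν ≤ ENNReal.ofReal μ) :
    (Measure.pi fun _ : Fin n => ν) {z | A ≤ ∑ i, Y (z i)} ≤
      ENNReal.ofReal (Real.exp (n * (b * μ)) / b ^ A) := by
  have hb0 : 0 < b := by linarith
  refine measure_le_ofReal_div (F := fun z : Fin n → α => ∏ i, b ^ Y (z i)) ?_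
    (Real.rpow_pos_of_pos hb0 A) ?_ ?_
  · refine Finset.measurable_prod _ fun i _ => ?_
    have : Measurable fun z : Fin n → α => Y (z i) := hY.comp (measurable_pi_apply i)
    exact measurable_const.pow this
  · intro z hz
    rw [← Real.rpow_sum_of_pos hb0]
    exact Real.rpow_le_rpow_of_exponent_le hb hz
  · have e : ∀ z : Fin n → α, ENNReal.ofReal (∏ i, b ^ Y (z i)) =
        ∏ i, ENNReal.ofReal (b ^ Y (z i)) := fun z =>
      ENNReal.ofReal_prod_of_nonneg fun i _ => by positivity
    simp_rw [e]
    rw [lintegral_pi_prod_eq ν (fun _ x => ENNReal.ofReal (b ^ Y x))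
      (fun _ => (measurable_const.pow hY).ennreal_ofReal)]
    have h2 : ∫⁻ x, ENNReal.ofReal (b ^ Y x) ∂ν ≤ ENNReal.ofReal (Real.exp (b * μ)) := by
      calc ∫⁻ x, ENNReal.ofReal (b ^ Y x) ∂ν
          ≤ ∫⁻ x, (1 + ENNReal.ofReal b * ENNReal.ofReal (Y x)) ∂ν := by
            refine lintegral_mono fun x => ?_
            rw [← ENNReal.ofReal_mul hb0.le, ← ENNReal.ofReal_one,
              ← ENNReal.ofReal_add zero_le_one (mul_nonneg hb0.le (h0 x))]
            exact ENNReal.ofReal_le_ofReal (rpow_le_one_add_mul hb (h0 x) (h1 x))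
        _ = 1 + ENNReal.ofReal b * ∫⁻ x, ENNReal.ofReal (Y x) ∂ν := by
            rw [lintegral_add_left measurable_const,
              lintegral_const_mul _ hY.ennreal_ofReal]
            simp
        _ ≤ 1 + ENNReal.ofReal b * ENNReal.ofReal μ := by gcongr
        _ ≤ ENNReal.ofReal (Real.exp (b * μ)) := by
            rw [← ENNReal.ofReal_mul hb0.le, ← ENNReal.ofReal_one,
              ← ENNReal.ofReal_add zero_le_one (mul_nonneg hb0.le hμ)]
            refine ENNReal.ofReal_le_ofReal ?_
            have := Real.add_one_le_exp (b * μ)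
            linarith
    calc ∏ _i : Fin n, ∫⁻ x, ENNReal.ofReal (b ^ Y x) ∂ν
        ≤ ∏ _i : Fin n, ENNReal.ofReal (Real.exp (b * μ)) :=
          Finset.prod_le_prod' fun _ _ => h2
      _ = ENNReal.ofReal (Real.exp (n * (b * μ))) := by
          rw [Finset.prod_const, Finset.card_univ, Fintype.card_fin,
            ← ENNReal.ofReal_pow (Real.exp_pos _).le, ← Real.exp_nat_mul]

/-- Tail bound for the empirical `a`-th absolute moment truncated at `τ = G y (n / H)^{1/a}`. -/
theorem measure_truncated_moment_le {α : Type*} [MeasurableSpace α] {n : ℕ} (ν : Measure α)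
    [IsProbabilityMeasure ν] {f : α → ℝ} (hf : Measurable f) {G y H a c τ : ℝ}
    (hG : 0 < G) (hy : 2 ≤ y) (hH : 0 < H) (ha : 2 ≤ a) (hn : 0 < n) (hc : 0 ≤ c)
    (hτ : τ = G * y * (n / H) ^ (1 / a))
    (hm : ∫⁻ x, ENNReal.ofReal (|f x| ^ a) ∂ν ≤ ENNReal.ofReal (G ^ a)) :
    (Measure.pi fun _ : Fin n => ν)
      {z | c * G ^ a * y ^ a * n ≤ ∑ i, if |f (z i)| ≤ τ then |f (z i)| ^ a else 0} ≤
      ENNReal.ofReal (y ^ (-(2 * (c - 1) * H))) := by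
  have hn' : (0 : ℝ) < n := by exact_mod_cast hn
  have hy0 : 0 < y := by linarith
  have ha0 : 0 < a := by linarith
  have hτ0 : 0 < τ := by rw [hτ]; positivity
  have hτa : τ ^ a = G ^ a * y ^ a * (n / H) := by
    rw [hτ, Real.mul_rpow (by positivity) (by positivity), Real.mul_rpow hG.le hy0.le,
      ← Real.rpow_mul (by positivity), one_div_mul_cancel ha0.ne', Real.rpow_one]
  set Y : α → ℝ := fun x => (if |f x| ≤ τ then |f x| ^ a else 0) / τ ^ a with hYdef
  have hYm : Measurable Y := by
    refine Measurable.div_const (Measurable.ite ?_ ?_ measurable_const) _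
    · exact measurableSet_le (by fun_prop) measurable_const
    · fun_prop
  have h0 : ∀ x, 0 ≤ Y x := by
    intro x; simp only [hYdef]; split_ifs <;> positivity
  have h1 : ∀ x, Y x ≤ 1 := by
    intro x; simp only [hYdef]; split_ifs with h
    · rw [div_le_one (by positivity)]
      exact Real.rpow_le_rpow (abs_nonneg _) h ha0.le
    · simp
  have hmean : ∫⁻ x, ENNReal.ofReal (Y x) ∂ν ≤ ENNReal.ofReal (G ^ a / τ ^ a) := by
    calc ∫⁻ x, ENNReal.ofReal (Y x) ∂ν
        ≤ ∫⁻ x, ENNReal.ofReal (|f x| ^ a) * ENNReal.ofReal (1 / τ ^ a) ∂ν := by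
          refine lintegral_mono fun x => ?_
          rw [← ENNReal.ofReal_mul (by positivity), mul_one_div]
          refine ENNReal.ofReal_le_ofReal ?_
          simp only [hYdef]
          gcongr
          split_ifs
          · exact le_rfl
          · positivity
      _ = (∫⁻ x, ENNReal.ofReal (|f x| ^ a) ∂ν) * ENNReal.ofReal (1 / τ ^ a) :=
          lintegral_mul_const _ (by fun_prop)
      _ ≤ ENNReal.ofReal (G ^ a) * ENNReal.ofReal (1 / τ ^ a) := by gcongr
      _ = _ := by rw [← ENNReal.ofReal_mul (by positivity), mul_one_div]
  have hya : 1 ≤ y ^ a := Real.one_le_rpow (by linarith) ha0.le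
  -- The base `b = y ^ a` is chosen so that `n b μ = H`; the rescaled threshold is `c H`, and the
  -- bound reads `e^H / y^(a c H)`.
  have key := measure_sum_ge_le_of_mem_Icc (n := n) ν hYm h0 h1 (A := c * H) (by positivity)
    hya hmean
  refine (measure_mono ?_).trans (key.trans (ENNReal.ofReal_le_ofReal ?_))
  · intro z hz
    simp only [Set.mem_ofPred_eq, hYdef] at hz ⊢
    rw [← Finset.sum_div, le_div_iff₀ (by positivity), hτa]
    refine le_trans (le_of_eq ?_) hz
    field_simp
  · have e1 : (n : ℝ) * (y ^ a * (G ^ a / τ ^ a)) = H := by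
      rw [hτa]
      have := (Real.rpow_pos_of_pos hy0 a).ne'
      have := (Real.rpow_pos_of_pos hG a).ne'
      field_simp
    rw [e1, div_le_iff₀ (by positivity), ← Real.rpow_mul hy0.le, ← Real.rpow_add hy0,
      Real.rpow_def_of_pos hy0]
    refine Real.exp_le_exp.2 ?_
    -- Thus `e^H ≤ y^(2H)`, which costs one unit of `c`; `a ≥ 2` does the rest.
    have hlog : 1 / 2 ≤ Real.log y := by
      have := Real.log_two_gt_d9
      have := Real.log_le_log (by norm_num) hy
      linarith
    have h3 : 0 ≤ c * H * (a - 2) := mul_nonneg (by positivity) (by linarith)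
    have : 2 * H ≤ -(2 * (c - 1) * H) + a * (c * H) := by nlinarith
    nlinarith

/-! ### Sign sums with random coefficients -/

theorem isProbabilityMeasure_signLaw : IsProbabilityMeasure signLaw :=
  ⟨by simp [signLaw, ENNReal.inv_two_add_inv_two]⟩

theorem lintegral_exp_signLaw (c : ℝ) :
    ∫⁻ e, ENNReal.ofReal (Real.exp (e * c)) ∂signLaw = ENNReal.ofReal (Real.cosh c) := by
  have hm : Measurable fun e : ℝ => ENNReal.ofReal (Real.exp (e * c)) := by fun_prop
  rw [signLaw, lintegral_add_measure, lintegral_smul_measure, lintegral_smul_measure,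
    lintegral_dirac' _ hm, lintegral_dirac' _ hm]
  have h2 : (2⁻¹ : ENNReal) = ENNReal.ofReal (1 / 2) := by
    rw [one_div, ENNReal.ofReal_inv_of_pos (by norm_num)]; simp
  rw [smul_eq_mul, smul_eq_mul, h2, ← ENNReal.ofReal_mul (by norm_num),
    ← ENNReal.ofReal_mul (by norm_num), ← ENNReal.ofReal_add (by positivity) (by positivity),
    Real.cosh_eq]
  congr 1
  simp only [one_mul, neg_mul]
  ring

/-- Exponential supermartingale bound for sign sums whose coefficients are independent of the
signs. -/
theorem lintegral_exp_sign_sum_le {β : Type*} [MeasurableSpace β] {n : ℕ} (μ : Measure β)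
    [IsProbabilityMeasure μ] {c : Fin n → β → ℝ} (hc : ∀ i, Measurable (c i)) :
    ∫⁻ x, ENNReal.ofReal
        (Real.exp (∑ i, x.1 i * c i x.2 - (∑ i, (c i x.2) ^ 2) / 2))
      ∂((Measure.pi fun _ : Fin n => signLaw).prod μ) ≤ 1 := by
  have := isProbabilityMeasure_signLaw
  rw [lintegral_prod_symm' _ (by fun_prop)]
  calc _ ≤ ∫⁻ _, 1 ∂μ := lintegral_mono fun z => ?_
    _ = 1 := by simp
  have e : ∀ x : Fin n → ℝ, ENNReal.ofReal
      (Real.exp (∑ i, x i * c i z - (∑ i, (c i z) ^ 2) / 2)) =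
      ∏ i, ENNReal.ofReal (Real.exp (x i * c i z)) * ENNReal.ofReal (Real.exp (-(c i z ^ 2 / 2))) := by
    intro x
    simp_rw [← ENNReal.ofReal_mul (Real.exp_pos _).le]
    rw [← ENNReal.ofReal_prod_of_nonneg (fun i _ => by positivity)]
    simp_rw [← Real.exp_add]
    rw [← Real.exp_sum, Finset.sum_add_distrib, Finset.sum_neg_distrib, Finset.sum_div,
      sub_eq_add_neg]
  simp only [e]
  rw [lintegral_pi_prod_eq signLaw
    (fun i e => ENNReal.ofReal (Real.exp (e * c i z)) * ENNReal.ofReal (Real.exp (-(c i z ^ 2 / 2))))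
    (fun i => by fun_prop)]
  refine Finset.prod_le_one' fun i _ => ?_
  rw [lintegral_mul_const _ (by fun_prop), lintegral_exp_signLaw,
    ← ENNReal.ofReal_mul (Real.cosh_pos _).le, Real.exp_neg]
  refine ENNReal.ofReal_le_one.2 ?_
  rw [← div_eq_mul_inv]
  exact div_le_one_of_le₀ (Real.cosh_le_exp_half_sq _) (Real.exp_pos _).le

/-- One-sided Hoeffding inequality with coefficients independent of the signs. -/
theorem measure_sign_sum_gt_le {β : Type*} [MeasurableSpace β] {n : ℕ} (μ : Measure β)
    [IsProbabilityMeasure μ] {b : Fin n → β → ℝ} (hb : ∀ i, Measurable (b i)) {s : ℝ} (hs : 0 ≤ s) :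
    ((Measure.pi fun _ : Fin n => signLaw).prod μ)
      {x | s * √(∑ i, b i x.2 ^ 2) < ∑ i, x.1 i * b i x.2} ≤
      ENNReal.ofReal (Real.exp (-(s ^ 2 / 2))) := by
  -- Self-normalised coefficients: `∑ c_i² = s²` whenever the `b_i` do not all vanish, so the
  -- exponential bound gives a deterministic tail.
  set c : Fin n → β → ℝ := fun i z => s * b i z / √(∑ k, b k z ^ 2) with hcdef
  have hc : ∀ i, Measurable (c i) := fun i => by fun_prop
  have hI := lintegral_exp_sign_sum_le μ hc
  have := measure_le_ofReal_div (I := 1) (B := Real.exp (s ^ 2 / 2))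
    (S := {x : (Fin n → ℝ) × β | s * √(∑ i, b i x.2 ^ 2) < ∑ i, x.1 i * b i x.2})
    (F := fun x => Real.exp (∑ i, x.1 i * c i x.2 - (∑ i, (c i x.2) ^ 2) / 2))
    (by fun_prop) (Real.exp_pos _) ?_ (by simpa using hI)
  · rwa [one_div, ← Real.exp_neg] at this
  · intro x hx
    simp only [Set.mem_ofPred_eq] at hx
    refine Real.exp_le_exp.2 ?_
    have hQ : 0 ≤ ∑ k, b k x.2 ^ 2 := Finset.sum_nonneg fun _ _ => sq_nonneg _
    rcases hQ.eq_or_lt with h0 | h0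
    -- If all coefficients vanish, the strict inequality defining the event reads `0 < 0`.
    · have hz : ∀ k, b k x.2 = 0 := fun k => by
        have := (Finset.sum_eq_zero_iff_of_nonneg (fun k _ => sq_nonneg (b k x.2))).1 h0.symm k
          (Finset.mem_univ k)
        simpa using this
      simp [hz] at hx
    · set R := √(∑ k, b k x.2 ^ 2) with hR
      have hR0 : 0 < R := Real.sqrt_pos.2 h0
      have hR2 : ∑ k, b k x.2 ^ 2 = R ^ 2 := (Real.sq_sqrt hQ).symm
      have e1 : ∑ i, x.1 i * c i x.2 = s / R * ∑ i, x.1 i * b i x.2 := by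
        rw [Finset.mul_sum]
        refine Finset.sum_congr rfl fun i _ => ?_
        simp only [hcdef, ← hR]
        ring
      have e2 : ∑ i, c i x.2 ^ 2 = s ^ 2 := by
        have : ∀ i, c i x.2 ^ 2 = s ^ 2 / R ^ 2 * b i x.2 ^ 2 := fun i => by
          simp only [hcdef, ← hR]
          ring
        simp_rw [this]
        rw [← Finset.mul_sum, hR2]
        field_simp
      have e3 : s ^ 2 ≤ s / R * ∑ i, x.1 i * b i x.2 := by
        calc s ^ 2 = s / R * (s * R) := by field_simp
          _ ≤ _ := mul_le_mul_of_nonneg_left hx.le (by positivity)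
      rw [e1, e2]
      linarith

/-- Two-sided Hoeffding inequality, uniform over finitely many families of coefficients. -/
theorem measure_exists_abs_sign_sum_gt_le {β : Type*} [MeasurableSpace β] {n d : ℕ}
    (μ : Measure β) [IsProbabilityMeasure μ] {b : Fin d → Fin n → β → ℝ}
    (hb : ∀ j i, Measurable (b j i)) {s : ℝ} (hs : 0 ≤ s) :
    ((Measure.pi fun _ : Fin n => signLaw).prod μ)
      {x | ∃ j, s * √(∑ i, b j i x.2 ^ 2) < |∑ i, x.1 i * b j i x.2|} ≤
      ENNReal.ofReal (2 * d * Real.exp (-(s ^ 2 / 2))) := by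
  have hsub : {x : (Fin n → ℝ) × β | ∃ j, s * √(∑ i, b j i x.2 ^ 2) < |∑ i, x.1 i * b j i x.2|} ⊆
      ⋃ j, ({x | s * √(∑ i, b j i x.2 ^ 2) < ∑ i, x.1 i * b j i x.2} ∪
        {x | s * √(∑ i, (-b j i x.2) ^ 2) < ∑ i, x.1 i * -b j i x.2}) := by
    rintro x ⟨j, hj⟩
    refine Set.mem_iUnion.2 ⟨j, ?_⟩
    rcases lt_abs.1 hj with h | h
    · exact Or.inl h
    · refine Or.inr ?_
      simpa [neg_sq, Finset.sum_neg_distrib] using h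
  refine (measure_mono hsub).trans ((measure_iUnion_fintype_le _ _).trans ?_)
  have h1 : ∀ j, ((Measure.pi fun _ : Fin n => signLaw).prod μ)
      ({x | s * √(∑ i, b j i x.2 ^ 2) < ∑ i, x.1 i * b j i x.2} ∪
        {x | s * √(∑ i, (-b j i x.2) ^ 2) < ∑ i, x.1 i * -b j i x.2}) ≤
      ENNReal.ofReal (2 * Real.exp (-(s ^ 2 / 2))) := fun j => by
    refine (measure_union_le _ _).trans ?_
    rw [two_mul, ENNReal.ofReal_add (Real.exp_pos _).le (Real.exp_pos _).le]
    exact add_le_add (measure_sign_sum_gt_le μ (hb j) hs)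
      (measure_sign_sum_gt_le μ (b := fun i z => -b j i z) (fun i => (hb j i).neg) hs)
  refine (Finset.sum_le_sum fun j _ => h1 j).trans ?_
  rw [Finset.sum_const, Finset.card_univ, Fintype.card_fin, nsmul_eq_mul,
    ← ENNReal.ofReal_natCast, ← ENNReal.ofReal_mul (by positivity)]
  exact ENNReal.ofReal_le_ofReal (by linarith)

/-! ### Moments of sums of independent nonnegative variables -/

/-- Moment growth `‖f‖_a ≤ √a` produces factors of the form `s^s`. Combined with the binomial
coefficient and normalised by `k^s`, they leave only `e^s`. -/
theorem choose_mul_div_pow_le {k s : ℕ} (hs : 1 ≤ s) (hk : s ≤ k) :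
    (k.choose s : ℝ) * ((s : ℝ) / k) ^ s ≤ Real.exp s := by
  have hk0 : (0 : ℝ) < k := by exact_mod_cast (by omega : 0 < k)
  have h1 : (k.choose s : ℝ) ≤ (k : ℝ) ^ s / s.factorial := Nat.choose_le_pow_div s k
  calc (k.choose s : ℝ) * ((s : ℝ) / k) ^ s ≤ (k : ℝ) ^ s / s.factorial * ((s : ℝ) / k) ^ s := by
        gcongr
    _ = (s : ℝ) ^ s / s.factorial := by
        rw [div_pow]
        field_simp
    _ ≤ Real.exp s := Real.pow_div_factorial_le_exp _ (by positivity) s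

theorem sum_le_prod_one_add {ι : Type*} (t : Finset ι) {y : ι → ℝ} (hy : ∀ i, 0 ≤ y i) :
    1 + ∑ i ∈ t, y i ≤ ∏ i ∈ t, (1 + y i) := by
  classical
  induction t using Finset.induction_on with
  | empty => simp
  | insert i t hi ih =>
    rw [Finset.sum_insert hi, Finset.prod_insert hi]
    have := mul_le_mul_of_nonneg_left ih (by linarith [hy i] : 0 ≤ 1 + y i)
    have h2 : 0 ≤ y i * ∑ i ∈ t, y i := mul_nonneg (hy i) (Finset.sum_nonneg fun i _ => hy i)
    nlinarith

/-- The hypothesis bounds each term of the binomial expansion by `2^(-s) δ`, so the terms with `s ≥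
1` add up to at most `δ`. -/
theorem lintegral_one_add_div_pow_le {α : Type*} [MeasurableSpace α] (ν : Measure α)
    [IsProbabilityMeasure ν] {W : α → ℝ} (hW : Measurable W) (h0 : ∀ x, 0 ≤ W x) {k : ℕ}
    {D δ : ℝ} (hD : 0 < D) (hδ : 0 ≤ δ)
    (hm : ∀ s : ℕ, 1 ≤ s → s ≤ k →
      (k.choose s : ENNReal) * ∫⁻ x, ENNReal.ofReal (W x ^ s) ∂ν ≤
        ENNReal.ofReal ((D / 2) ^ s * δ)) :
    ∫⁻ x, ENNReal.ofReal ((1 + W x / D) ^ k) ∂ν ≤ ENNReal.ofReal (1 + δ) := by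
  have e : ∀ x, ENNReal.ofReal ((1 + W x / D) ^ k) = ∑ s ∈ Finset.range (k + 1),
      ENNReal.ofReal ((1 / D) ^ s) * ((k.choose s : ENNReal) * ENNReal.ofReal (W x ^ s)) := by
    intro x
    have hWx := h0 x
    rw [add_comm, add_pow, ENNReal.ofReal_sum_of_nonneg (fun s _ => by positivity)]
    refine Finset.sum_congr rfl fun s _ => ?_
    rw [← ENNReal.ofReal_natCast, ← ENNReal.ofReal_mul (by positivity),
      ← ENNReal.ofReal_mul (by positivity)]
    congr 1
    rw [one_pow, div_pow, div_pow]
    ring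
  simp_rw [e]
  rw [lintegral_finsetSum _ (fun s _ => by fun_prop), Finset.sum_range_succ']
  have h1 : ∀ s ∈ Finset.range k, ∫⁻ x, ENNReal.ofReal ((1 / D) ^ (s + 1)) *
      ((k.choose (s + 1) : ENNReal) * ENNReal.ofReal (W x ^ (s + 1))) ∂ν ≤
      ENNReal.ofReal ((1 / 2 : ℝ) ^ (s + 1) * δ) := by
    intro s hs
    have hs' : s + 1 ≤ k := Finset.mem_range.1 hs
    rw [lintegral_const_mul _ (by fun_prop), lintegral_const_mul _ (by fun_prop)]
    refine (mul_le_mul_right (hm (s + 1) (by omega) hs') _).trans ?_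
    rw [← ENNReal.ofReal_mul (by positivity)]
    refine ENNReal.ofReal_le_ofReal (le_of_eq ?_)
    rw [← mul_assoc, ← mul_pow]
    congr 2
    field_simp
  refine (add_le_add_left (Finset.sum_le_sum h1) _).trans ?_
  rw [← ENNReal.ofReal_sum_of_nonneg (fun s _ => by positivity)]
  have h2 : ∫⁻ x, ENNReal.ofReal ((1 / D) ^ 0) *
      ((k.choose 0 : ENNReal) * ENNReal.ofReal (W x ^ 0)) ∂ν = ENNReal.ofReal 1 := by simp
  rw [h2, ← ENNReal.ofReal_add (Finset.sum_nonneg fun s _ => by positivity) zero_le_one]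
  refine ENNReal.ofReal_le_ofReal ?_
  have h3 : ∑ s ∈ Finset.range k, (1 / 2 : ℝ) ^ (s + 1) ≤ 1 := by
    have h4 : ∀ k : ℕ, ∑ s ∈ Finset.range k, (1 / 2 : ℝ) ^ (s + 1) = 1 - (1 / 2) ^ k := by
      intro k
      induction k with
      | zero => simp
      | succ k ih => rw [Finset.sum_range_succ, ih]; ring
    rw [h4]
    have : (0 : ℝ) ≤ (1 / 2) ^ k := by positivity
    linarith
  rw [← Finset.sum_mul]
  nlinarith

/-- Moments of a sum of independent copies of a nonnegative function, bounded through
`∑ Wᵢ / D ≤ ∏ (1 + Wᵢ / D)`. -/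
theorem lintegral_sum_pow_le {α : Type*} [MeasurableSpace α] {n : ℕ} (ν : Measure α)
    [IsProbabilityMeasure ν] {W : α → ℝ} (hW : Measurable W) (h0 : ∀ x, 0 ≤ W x) {k : ℕ}
    {D δ : ℝ} (hD : 0 < D) (hδ : 0 ≤ δ)
    (hm : ∀ s : ℕ, 1 ≤ s → s ≤ k →
      (k.choose s : ENNReal) * ∫⁻ x, ENNReal.ofReal (W x ^ s) ∂ν ≤
        ENNReal.ofReal ((D / 2) ^ s * δ)) :
    ∫⁻ z, ENNReal.ofReal ((∑ i, W (z i)) ^ k) ∂(Measure.pi fun _ : Fin n => ν) ≤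
      ENNReal.ofReal (D ^ k * Real.exp (n * δ)) := by
  have h1 := lintegral_one_add_div_pow_le ν hW h0 hD hδ hm
  calc _ ≤ ∫⁻ z, ENNReal.ofReal (D ^ k) * ∏ i, ENNReal.ofReal ((1 + W (z i) / D) ^ k)
          ∂(Measure.pi fun _ : Fin n => ν) := by
        refine lintegral_mono fun z => ?_
        have hnn : ∀ i, 0 ≤ W (z i) / D := fun i => div_nonneg (h0 _) hD.le
        rw [← ENNReal.ofReal_prod_of_nonneg (fun i _ => pow_nonneg (by linarith [hnn i]) _),
          ← ENNReal.ofReal_mul (by positivity), Finset.prod_pow, ← mul_pow]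
        refine ENNReal.ofReal_le_ofReal ?_
        have hs : 0 ≤ ∑ i, W (z i) := Finset.sum_nonneg fun i _ => h0 _
        refine pow_le_pow_left₀ hs ?_ k
        have := sum_le_prod_one_add Finset.univ hnn
        rw [← Finset.sum_div] at this
        calc ∑ i, W (z i) = D * ((∑ i, W (z i)) / D) := by field_simp
          _ ≤ _ := mul_le_mul_of_nonneg_left (by linarith) hD.le
    _ = ENNReal.ofReal (D ^ k) * ∏ _i : Fin n, ∫⁻ x, ENNReal.ofReal ((1 + W x / D) ^ k) ∂ν := by
        rw [lintegral_const_mul', lintegral_pi_prod_eq ν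
          (fun _ x => ENNReal.ofReal ((1 + W x / D) ^ k)) (fun _ => by fun_prop)]
        simp
    _ ≤ ENNReal.ofReal (D ^ k) * ∏ _i : Fin n, ENNReal.ofReal (Real.exp δ) := by
        refine mul_le_mul_right (Finset.prod_le_prod' fun _ _ => h1.trans ?_) _
        refine ENNReal.ofReal_le_ofReal ?_
        linarith [Real.add_one_le_exp δ]
    _ = _ := by
        rw [Finset.prod_const, Finset.card_univ, Fintype.card_fin,
          ← ENNReal.ofReal_pow (Real.exp_pos _).le, ← Real.exp_nat_mul,
          ← ENNReal.ofReal_mul (by positivity)]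

/-- Hölder with exponents `1 / (1 - η)` and `1 / η`: smallness of `A` is gained at the price of a
moment `1 / η` times higher. -/
theorem lintegral_indicator_rpow_le {α : Type*} [MeasurableSpace α] (ν : Measure α)
    {f : α → ℝ} (hf : Measurable f) {A : Set α} (hA : MeasurableSet A)
    {c η : ℝ} (hη : 0 < η) (hη1 : η < 1) :
    ∫⁻ x, ENNReal.ofReal (A.indicator (fun x => |f x| ^ c) x) ∂ν ≤
      ν A ^ (1 - η) * (∫⁻ x, ENNReal.ofReal (|f x| ^ (c / η)) ∂ν) ^ η := by
  have hpq : (1 / (1 - η)).HolderConjugate (1 / η) := by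
    rw [Real.holderConjugate_iff]
    refine ⟨by rw [lt_div_iff₀] <;> linarith, by simp⟩
  have hF : Measurable (A.indicator fun _ => (1 : ENNReal)) := measurable_const.indicator hA
  have hG : Measurable fun x => ENNReal.ofReal (|f x| ^ c) := by fun_prop
  have h := ENNReal.lintegral_mul_le_Lp_mul_Lq ν hpq hF.aemeasurable hG.aemeasurable
  have e1 : ∫⁻ x, (A.indicator fun _ => (1 : ENNReal)) x ^ (1 / (1 - η)) ∂ν = ν A := by
    have : ∀ x, (A.indicator fun _ => (1 : ENNReal)) x ^ (1 / (1 - η)) =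
        A.indicator (fun _ => (1 : ENNReal)) x := by
      intro x
      by_cases hx : x ∈ A
      · simp [hx]
      · simp only [hx, not_false_eq_true, Set.indicator_of_notMem]
        exact ENNReal.zero_rpow_of_pos (by have : 0 < 1 - η := by linarith
                                           positivity)
    simp_rw [this]
    rw [lintegral_indicator_const hA, one_mul]
  have e2 : ∀ x, ENNReal.ofReal (|f x| ^ c) ^ (1 / η) = ENNReal.ofReal (|f x| ^ (c / η)) := by
    intro x
    rw [ENNReal.ofReal_rpow_of_nonneg (by positivity) (by positivity),
      ← Real.rpow_mul (abs_nonneg _), mul_one_div]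
  rw [e1] at h
  simp_rw [e2] at h
  rw [one_div_one_div, one_div_one_div] at h
  refine le_trans (lintegral_mono fun x => ?_) h
  by_cases hx : x ∈ A <;> simp [hx]

theorem choose_mul_rpow_le {k s : ℕ} (hs : 1 ≤ s) (hk : s ≤ k) {p a θ : ℝ} (hp : 0 < p)
    (ha1 : 1 ≤ a) (ha2 : a ≤ 2) (hθ : 0 < θ) (hθ1 : θ ≤ 1) :
    (k.choose s : ℝ) * (p * (2 / θ * (s / k))) ^ (a * s) ≤
      (p ^ a * (4 * Real.exp 1 / θ ^ 2)) ^ s := by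
  have hs0 : (0 : ℝ) < s := by exact_mod_cast hs
  have hk0 : (0 : ℝ) < k := by exact_mod_cast (by omega : 0 < k)
  have hz1 : (s : ℝ) / k ≤ 1 := by
    rw [div_le_one hk0]
    exact_mod_cast hk
  have hz : 0 < (s : ℝ) / k := by positivity
  have h2 : 1 ≤ 2 / θ := by
    rw [le_div_iff₀ hθ]
    linarith
  rw [Real.mul_rpow hp.le (by positivity), Real.mul_rpow (by positivity) hz.le]
  have e1 : (2 / θ) ^ (a * s) ≤ (4 / θ ^ 2) ^ s := by
    calc (2 / θ) ^ (a * s) ≤ (2 / θ) ^ ((2 * s : ℕ) : ℝ) := by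
          refine Real.rpow_le_rpow_of_exponent_le h2 ?_
          push_cast
          nlinarith
      _ = _ := by
          rw [Real.rpow_natCast, pow_mul]
          congr 1
          ring
  have e2 : ((s : ℝ) / k) ^ (a * s) ≤ ((s : ℝ) / k) ^ s := by
    rw [← Real.rpow_natCast]
    exact Real.rpow_le_rpow_of_exponent_ge hz hz1 (by nlinarith)
  have e3 : p ^ (a * s) = (p ^ a) ^ s := by rw [Real.rpow_mul hp.le, Real.rpow_natCast]
  have e4 := choose_mul_div_pow_le hs hk
  calc (k.choose s : ℝ) * (p ^ (a * s) * ((2 / θ) ^ (a * s) * ((s : ℝ) / k) ^ (a * s)))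
      ≤ (k.choose s : ℝ) * ((p ^ a) ^ s * ((4 / θ ^ 2) ^ s * ((s : ℝ) / k) ^ s)) := by
        rw [e3]
        gcongr
    _ = (p ^ a) ^ s * (4 / θ ^ 2) ^ s * ((k.choose s : ℝ) * ((s : ℝ) / k) ^ s) := by ring
    _ ≤ (p ^ a) ^ s * (4 / θ ^ 2) ^ s * Real.exp s := by gcongr
    _ = _ := by
        rw [show Real.exp s = Real.exp 1 ^ s by rw [← Real.exp_nat_mul, mul_one], ← mul_pow,
          ← mul_pow]
        congr 1
        ring

/-- A low power `s ≤ ηk` leaves room for Hölder, since the order `2as / η` stays below `2p`, and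
this gains `ν(A)^(1 - η)`. For a high power the indicator is dropped; but then `e^(s/η) ≥ e^k ≥ n`,
so a constant factor per power buys the gain `1 / n` instead. -/
theorem choose_mul_lintegral_indicator_le {α : Type*} [MeasurableSpace α] {n : ℕ} (hn : 1 ≤ n)
    (ν : Measure α) [IsProbabilityMeasure ν] {f : α → ℝ} (hf : Measurable f) {A : Set α}
    (hA : MeasurableSet A) {p η a : ℝ} {k s : ℕ} (hp : 1 ≤ p) (hη : 0 < η) (hη1 : η < 1)
    (hm : ∀ a : ℝ, 2 ≤ a → a ≤ 2 * p →
      ∫⁻ x, ENNReal.ofReal (|f x| ^ a) ∂ν ≤ ENNReal.ofReal (√a ^ a))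
    (ha1 : 1 ≤ a) (ha2 : a ≤ 2) (hak : a * k = p) (hnk : Real.log n ≤ k)
    (hs : 1 ≤ s) (hk : s ≤ k) :
    (k.choose s : ENNReal) *
      ∫⁻ x, ENNReal.ofReal (A.indicator (fun x => |f x| ^ (2 * a)) x ^ s) ∂ν ≤
      ENNReal.ofReal ((8 * Real.exp 1 / η ^ 2 * Real.exp (1 / η) * p ^ a / 2) ^ s *
        (ν.real A ^ (1 - η) + 1 / n)) := by
  have hn0 : (0 : ℝ) < n := by exact_mod_cast hn
  have hs1 : (1 : ℝ) ≤ s := by exact_mod_cast hs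
  have hsk : (s : ℝ) ≤ k := by exact_mod_cast hk
  have hk0 : (0 : ℝ) < k := by linarith
  have hp0 : 0 < p := by linarith
  have e1 : ∀ x, A.indicator (fun x => |f x| ^ (2 * a)) x ^ s =
      A.indicator (fun x => |f x| ^ (2 * a * s)) x := by
    intro x
    by_cases hx : x ∈ A
    · simp only [hx, Set.indicator_of_mem]
      rw [Real.rpow_mul (abs_nonneg _) (2 * a), Real.rpow_natCast]
    · simp only [hx, not_false_eq_true, Set.indicator_of_notMem]
      exact zero_pow (by omega)
  simp_rw [e1]
  rw [← ENNReal.ofReal_natCast]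
  have hrw : ∀ θ : ℝ, 0 < θ → 2 * a * s / θ = p * (2 / θ * (s / k)) := fun θ hθ => by
    rw [← hak]
    field_simp
  have hcK : (1 : ℝ) ≤ Real.exp (1 / η) := Real.one_le_exp (by positivity)
  rcases le_or_gt (s : ℝ) (η * k) with hcase | hcase
  · have hb2 : 2 ≤ 2 * a * s / η := by
      rw [le_div_iff₀ hη]
      nlinarith
    have hbp : 2 * a * s / η ≤ 2 * p := by
      rw [div_le_iff₀ hη, ← hak]
      nlinarith
    have hb0 : 0 ≤ 2 * a * s / η := by linarith
    have h1 : ∫⁻ x, ENNReal.ofReal (A.indicator (fun x => |f x| ^ (2 * a * s)) x) ∂ν ≤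
        ENNReal.ofReal (ν.real A ^ (1 - η) * (2 * a * s / η) ^ (a * s)) := by
      refine (lintegral_indicator_rpow_le ν hf hA hη hη1).trans ?_
      have e2 : (√(2 * a * s / η) ^ (2 * a * s / η)) ^ η = (2 * a * s / η) ^ (a * s) := by
        rw [← Real.rpow_mul (Real.sqrt_nonneg _), div_mul_cancel₀ _ hη.ne', Real.sqrt_eq_rpow,
          ← Real.rpow_mul hb0]
        congr 1
        ring
      have e3 : ν A = ENNReal.ofReal (ν.real A) := by simp [Measure.real]
      rw [← e2, ENNReal.ofReal_mul (by positivity), ← ENNReal.ofReal_rpow_of_nonneg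
        (by positivity) hη.le, ← ENNReal.ofReal_rpow_of_nonneg (by positivity) (by linarith), ← e3]
      gcongr
      exact hm _ hb2 hbp
    refine (mul_le_mul_right h1 _).trans ?_
    rw [← ENNReal.ofReal_mul (by positivity)]
    refine ENNReal.ofReal_le_ofReal ?_
    have h2 := choose_mul_rpow_le hs hk hp0 ha1 ha2 hη hη1.le
    rw [hrw η hη]
    have h3 : (p ^ a * (4 * Real.exp 1 / η ^ 2)) ^ s ≤
        (8 * Real.exp 1 / η ^ 2 * Real.exp (1 / η) * p ^ a / 2) ^ s := by
      refine pow_le_pow_left₀ (by positivity) ?_ _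
      have : 0 ≤ p ^ a * (4 * Real.exp 1 / η ^ 2) := by positivity
      calc p ^ a * (4 * Real.exp 1 / η ^ 2)
          ≤ p ^ a * (4 * Real.exp 1 / η ^ 2) * Real.exp (1 / η) := le_mul_of_one_le_right this hcK
        _ = _ := by ring
    calc (k.choose s : ℝ) * (ν.real A ^ (1 - η) * (p * (2 / η * (s / k))) ^ (a * s))
        = (k.choose s : ℝ) * (p * (2 / η * (s / k))) ^ (a * s) * ν.real A ^ (1 - η) := by ring
      _ ≤ (8 * Real.exp 1 / η ^ 2 * Real.exp (1 / η) * p ^ a / 2) ^ s * ν.real A ^ (1 - η) := by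
          gcongr
          exact h2.trans h3
      _ ≤ _ := by
          gcongr
          have : (0 : ℝ) ≤ 1 / n := by positivity
          linarith
  · have hb2 : 2 ≤ 2 * a * s := by nlinarith
    have hbp : 2 * a * s ≤ 2 * p := by
      rw [← hak]
      nlinarith
    have h1 : ∫⁻ x, ENNReal.ofReal (A.indicator (fun x => |f x| ^ (2 * a * s)) x) ∂ν ≤
        ENNReal.ofReal ((2 * a * s) ^ (a * s)) := by
      have e2 : √(2 * a * s) ^ (2 * a * s) = (2 * a * s) ^ (a * s) := by
        rw [Real.sqrt_eq_rpow, ← Real.rpow_mul (by linarith)]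
        congr 1
        ring
      rw [← e2]
      refine le_trans (lintegral_mono fun x => ENNReal.ofReal_le_ofReal ?_) (hm _ hb2 hbp)
      by_cases hx : x ∈ A
      · simp [hx]
      · simp only [hx, not_false_eq_true, Set.indicator_of_notMem]
        positivity
    refine (mul_le_mul_right h1 _).trans ?_
    rw [← ENNReal.ofReal_mul (by positivity)]
    refine ENNReal.ofReal_le_ofReal ?_
    have h2 := choose_mul_rpow_le hs hk hp0 ha1 ha2 one_pos le_rfl
    have h4 := hrw 1 one_pos
    rw [div_one] at h4
    rw [h4]
    have h5 : (n : ℝ) ≤ Real.exp (1 / η) ^ s := by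
      rw [← Real.exp_nat_mul, ← Real.log_le_iff_le_exp hn0]
      refine hnk.trans ?_
      rw [mul_one_div, le_div_iff₀ hη]
      linarith
    have h6 : (1 : ℝ) ≤ 1 / η ^ 2 := by
      rw [le_div_iff₀ (by positivity)]
      nlinarith
    have h7 : (p ^ a * (4 * Real.exp 1 / 1 ^ 2)) ^ s ≤
        (8 * Real.exp 1 / η ^ 2 * Real.exp (1 / η) * p ^ a / 2) ^ s * (1 / n) := by
      calc (p ^ a * (4 * Real.exp 1 / 1 ^ 2)) ^ s
          ≤ (p ^ a * (4 * Real.exp 1 / 1 ^ 2)) ^ s * (Real.exp (1 / η) ^ s * (1 / n)) := by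
            refine le_mul_of_one_le_right (by positivity) ?_
            rw [mul_one_div, le_div_iff₀ hn0]
            linarith
        _ = (p ^ a * (4 * Real.exp 1) * Real.exp (1 / η)) ^ s * (1 / n) := by
            rw [mul_pow _ (Real.exp (1 / η))]
            ring
        _ ≤ _ := by
            gcongr
            have : 0 ≤ p ^ a * (4 * Real.exp 1) * Real.exp (1 / η) := by positivity
            calc _ ≤ p ^ a * (4 * Real.exp 1) * Real.exp (1 / η) * (1 / η ^ 2) :=
                  le_mul_of_one_le_right this h6
              _ = _ := by ring
    refine (h2.trans h7).trans ?_
    gcongr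
    have : 0 ≤ ν.real A ^ (1 - η) := by positivity
    linarith

/-- If `‖f‖_a ≤ √a` for `2 ≤ a ≤ 2p`, then the sum of `f²` over the sample points that fall in a
set of small measure is at most of order `p`. -/
theorem measure_sum_indicator_sq_le {α : Type*} [MeasurableSpace α] {n : ℕ} (hn : 1 ≤ n)
    (ν : Measure α) [IsProbabilityMeasure ν] {f : α → ℝ} (hf : Measurable f) {A : Set α}
    (hA : MeasurableSet A) {p η u : ℝ} (hp : 1 ≤ p) (hη : 0 < η) (hη1 : η < 1) (hu : 0 < u)
    (hm : ∀ a : ℝ, 2 ≤ a → a ≤ 2 * p →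
      ∫⁻ x, ENNReal.ofReal (|f x| ^ a) ∂ν ≤ ENNReal.ofReal (√a ^ a))
    (hνA : n * ν.real A ^ (1 - η) ≤ 2 * p) (hnp : 2 * Real.log n ≤ p) :
    (Measure.pi fun _ : Fin n => ν)
      {z | 8 / η ^ 2 * Real.exp (1 / η + 8) * u ^ 2 * p ≤
        ∑ i, A.indicator (fun x => f x ^ 2) (z i)} ≤
      ENNReal.ofReal (Real.exp (-(3 * p)) * u ^ (-(2 * p))) := by
  have hn0 : (0 : ℝ) < n := by exact_mod_cast hn
  have hn1 : (1 : ℝ) ≤ n := by exact_mod_cast hn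
  have hp0 : 0 < p := by linarith
  -- The product argument needs an integer power. With `a = p / k ∈ [1, 2]`, the `k`-th moment of `∑
  -- |f|^(2a)` reaches the order `2ak = 2p` of `f` exactly.
  set k := ⌊p⌋₊ with hkdef
  have hk1 : 1 ≤ k := Nat.one_le_floor_iff p |>.2 hp
  have hk1' : (1 : ℝ) ≤ k := by exact_mod_cast hk1
  have hkp : (k : ℝ) ≤ p := Nat.floor_le hp0.le
  have hpk : p < k + 1 := Nat.lt_floor_add_one p
  set a := p / k with hadef
  have hak : a * k = p := by rw [hadef]; field_simp
  have ha1 : 1 ≤ a := by rw [hadef, le_div_iff₀] <;> linarith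
  have ha2 : a ≤ 2 := by rw [hadef, div_le_iff₀] <;> linarith
  have hnk : Real.log n ≤ k := by linarith
  set K := 8 * Real.exp 1 / η ^ 2 * Real.exp (1 / η) with hK
  have hK0 : 0 < K := by positivity
  set W : α → ℝ := A.indicator (fun x => |f x| ^ (2 * a)) with hWdef
  have hW : Measurable W := Measurable.indicator (by fun_prop) hA
  have hW0 : ∀ x, 0 ≤ W x := fun x => Set.indicator_nonneg (fun x _ => by positivity) x
  have key := lintegral_sum_pow_le (n := n) ν hW hW0 (k := k) (D := K * p ^ a)
    (δ := ν.real A ^ (1 - η) + 1 / n) (by positivity) (by positivity)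
    (fun s hs hk => choose_mul_lintegral_indicator_le hn ν hf hA hp hη hη1 hm ha1 ha2 hak hnk hs hk)
  set B := 8 / η ^ 2 * Real.exp (1 / η + 8) * u ^ 2 * p with hB
  have hB0 : 0 < B := by positivity
  have hBK : B = K * Real.exp 7 * (u ^ 2 * p) := by
    rw [hB, hK, show Real.exp (1 / η + 8) = Real.exp 1 * Real.exp (1 / η) * Real.exp 7 by
      rw [← Real.exp_add, ← Real.exp_add]; congr 1; ring]
    ring
  refine (measure_le_ofReal_div (F := fun z : Fin n → α => (∑ i, W (z i)) ^ k)
    (B := B ^ p / n) ?_ (by positivity) ?_ key).trans (ENNReal.ofReal_le_ofReal ?_)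
  · refine Measurable.pow_const (Finset.measurable_sum _ fun i _ => ?_) _
    exact hW.comp (measurable_pi_apply i)
  · intro z hz
    simp only [Set.mem_ofPred_eq] at hz
    have hZ0 : ∀ i, 0 ≤ A.indicator (fun x => f x ^ 2) (z i) := fun i =>
      Set.indicator_nonneg (fun x _ => by positivity) _
    have e1 : ∀ x, A.indicator (fun x => f x ^ 2) x ^ a = W x := by
      intro x
      by_cases hx : x ∈ A
      · simp only [hWdef, hx, Set.indicator_of_mem]
        rw [← sq_abs, ← Real.rpow_natCast, ← Real.rpow_mul (abs_nonneg _)]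
        norm_num
      · simp only [hWdef, hx, not_false_eq_true, Set.indicator_of_notMem]
        exact Real.zero_rpow (by linarith)
    -- Passing from `∑ f²` to `∑ |f|^(2a)` by convexity costs `n^(a - 1)`, hence `n^(p - k) ≤ n`
    -- after the `k`-th power; this is the `n` in the Markov level `B ^ p / n`.
    have h1 := Real.rpow_sum_le_const_mul_sum_rpow_of_nonneg (s := Finset.univ) ha1
      (fun i _ => hZ0 i)
    simp_rw [e1] at h1
    rw [Finset.card_univ, Fintype.card_fin] at h1
    have h2 : B ^ a ≤ (n : ℝ) ^ (a - 1) * ∑ i, W (z i) :=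
      (Real.rpow_le_rpow hB0.le hz (by linarith)).trans h1
    have h3 := pow_le_pow_left₀ (by positivity) h2 k
    rw [← Real.rpow_natCast, ← Real.rpow_mul hB0.le, hak, mul_pow, ← Real.rpow_natCast,
      ← Real.rpow_mul hn0.le] at h3
    rw [div_le_iff₀ hn0]
    refine h3.trans ?_
    rw [mul_comm]
    refine mul_le_mul_of_nonneg_left ?_ (pow_nonneg (Finset.sum_nonneg fun i _ => hW0 _) _)
    calc (n : ℝ) ^ ((a - 1) * k) ≤ (n : ℝ) ^ (1 : ℝ) :=
          Real.rpow_le_rpow_of_exponent_le hn1 (by nlinarith)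
      _ = n := Real.rpow_one _
  · have e1 : (n : ℝ) * (ν.real A ^ (1 - η) + 1 / n) ≤ 2 * p + 1 := by
      rw [mul_add, mul_one_div_cancel hn0.ne']
      linarith
    have e2 : (K * p ^ a) ^ k = K ^ k * p ^ p := by
      rw [mul_pow, ← Real.rpow_natCast (p ^ a), ← Real.rpow_mul hp0.le, hak]
    have hK1 : 1 ≤ K := by
      have h1 : 1 ≤ Real.exp 1 := Real.one_le_exp zero_le_one
      have h2 : 1 ≤ Real.exp (1 / η) := Real.one_le_exp (by positivity)
      have h3 : 1 ≤ 8 / η ^ 2 := by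
        rw [le_div_iff₀ (by positivity)]
        nlinarith
      calc (1 : ℝ) ≤ 8 / η ^ 2 * Real.exp 1 * Real.exp (1 / η) :=
            one_le_mul_of_one_le_of_one_le (one_le_mul_of_one_le_of_one_le h3 h1) h2
        _ = K := by rw [hK]; ring
    have e3 : K ^ k ≤ K ^ p := by
      rw [← Real.rpow_natCast]
      exact Real.rpow_le_rpow_of_exponent_le hK1 hkp
    have e4 : (n : ℝ) ≤ Real.exp p := by
      rw [← Real.log_le_iff_le_exp hn0]
      have := Real.log_nonneg hn1
      linarith
    have e5 : B ^ p = K ^ p * Real.exp (7 * p) * u ^ (2 * p) * p ^ p := by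
      rw [hBK, Real.mul_rpow (by positivity) (by positivity), Real.mul_rpow hK0.le (by positivity),
        Real.mul_rpow (by positivity) hp0.le, ← Real.exp_mul, Real.rpow_mul hu.le]
      norm_num
      ring
    -- The reserve `e^(7p)` in `B ^ p` pays for `e^(2p+1)` from the moment bound and for `n ≤ e^p`,
    -- and leaves `e^(-3p)` since `p ≥ 1`.
    rw [div_div_eq_mul_div, div_le_iff₀ (by positivity), e2, e5, Real.rpow_neg hu.le]
    have hup : 0 < u ^ (2 * p) := by positivity
    calc K ^ k * p ^ p * Real.exp (n * (ν.real A ^ (1 - η) + 1 / n)) * n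
        ≤ K ^ p * p ^ p * Real.exp (2 * p + 1) * Real.exp p := by gcongr
      _ ≤ K ^ p * p ^ p * (Real.exp (-(3 * p)) * Real.exp (7 * p)) := by
          have : Real.exp (2 * p + 1) * Real.exp p ≤ Real.exp (-(3 * p)) * Real.exp (7 * p) := by
            rw [← Real.exp_add, ← Real.exp_add]
            exact Real.exp_le_exp.2 (by linarith)
          rw [mul_assoc]
          gcongr
      _ = _ := by field_simp

/-! ### Empirical second moment of the heavy-tailed noise -/

theorem half_le_log {y : ℝ} (hy : 2 ≤ y) : 1 / 2 ≤ Real.log y := by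
  have := Real.log_two_gt_d9
  have := Real.log_le_log (by norm_num) hy
  linarith

theorem measure_abs_gt_le {α : Type*} [MeasurableSpace α] {ν : Measure α} {f : α → ℝ}
    (hf : Measurable f) {a τ I : ℝ} (hτ : 0 < τ) (ha : 0 ≤ a)
    (hm : ∫⁻ x, ENNReal.ofReal (|f x| ^ a) ∂ν ≤ ENNReal.ofReal I) :
    ν {x | τ < |f x|} ≤ ENNReal.ofReal (I / τ ^ a) :=
  measure_le_ofReal_div (F := fun x => |f x| ^ a) (by fun_prop) (by positivity)
    (fun _ hx => Real.rpow_le_rpow hτ.le (le_of_lt hx) ha) hm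

theorem lintegral_rpow_le_one_of_le {α : Type*} [MeasurableSpace α] {ν : Measure α}
    [IsProbabilityMeasure ν] {g : α → ℝ} (hg : Measurable g) {a q : ℝ} (ha : 0 < a) (haq : a < q)
    (hm : ∫⁻ x, ENNReal.ofReal (|g x| ^ q) ∂ν ≤ 1) :
    ∫⁻ x, ENNReal.ofReal (|g x| ^ a) ∂ν ≤ 1 := by
  have hq : 0 < q := ha.trans haq
  have h := lintegral_indicator_rpow_le ν hg MeasurableSet.univ (c := a) (η := a / q)
    (by positivity) (by rw [div_lt_one hq]; exact haq)
  simp only [Set.indicator_univ, measure_univ, ENNReal.one_rpow, one_mul] at h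
  rw [show a / (a / q) = q by field_simp] at h
  refine h.trans ?_
  calc _ ≤ (1 : ENNReal) ^ (a / q) := by gcongr
    _ = 1 := ENNReal.one_rpow _

/-- Numerical comparison between a Chernoff bound and the heavy-tailed union bound. -/
theorem rpow_neg_le_log_rpow_div {n : ℕ} (hn : 2 ≤ n) {q w H : ℝ} (hq : 2 < q) (hw : 2 ≤ w)
    (hH : Real.log n / 2 ≤ H) :
    w ^ (-(2 * ((1 + 20 * q) - 1) * H)) ≤
      Real.log n ^ q / (w ^ q * (n : ℝ) ^ (q / 2 - 1)) := by
  have hn2 : (2 : ℝ) ≤ n := by exact_mod_cast hn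
  have hn0 : (0 : ℝ) < n := by linarith
  have hw0 : 0 < w := by linarith
  set l := Real.log n with hl
  have hl2 : 0.69 ≤ l := by
    have := Real.log_two_gt_d9
    have := Real.log_le_log (by norm_num) hn2
    linarith
  have hl0 : 0 < l := by linarith
  have hlw : 0.69 ≤ Real.log w := by
    have := Real.log_two_gt_d9
    have := Real.log_le_log (by norm_num) hw
    linarith
  rw [Real.rpow_def_of_pos hw0, Real.rpow_def_of_pos hl0, Real.rpow_def_of_pos hw0,
    Real.rpow_def_of_pos hn0, ← Real.exp_add, ← Real.exp_sub, ← hl]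
  refine Real.exp_le_exp.2 ?_
  -- For `n = 2` one has `log n < 1`, so the factor `log n ^ q` can be small and its logarithm needs
  -- a lower bound.
  have h1 : -1 ≤ Real.log l := by
    have h2 := Real.one_sub_inv_le_log_of_pos hl0
    have : l⁻¹ ≤ 2 := by
      rw [inv_le_comm₀ hl0 (by norm_num)]
      linarith
    linarith
  have h3 : 20 * l * Real.log w ≤ 40 * H * Real.log w := by nlinarith
  have h4 : 0.69 * (20 * l - 1) ≤ Real.log w * (20 * l - 1) :=
    mul_le_mul_of_nonneg_right hlw (by linarith)
  have h5 : 0 ≤ Real.log w * (40 * H - 1) + Real.log l - l / 2 := by nlinarith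
  have h6 := mul_nonneg (by linarith : 0 ≤ q) h5
  nlinarith

/-- The squares of heavy-tailed independent copies sum up to `O(w² n)`. -/
theorem measure_sum_sq_noise_le {α : Type*} [MeasurableSpace α] {n : ℕ} (hn : 2 ≤ n)
    (ν : Measure α) [IsProbabilityMeasure ν] {g : α → ℝ} (hg : Measurable g) {q w : ℝ}
    (hq : 2 < q) (hw : 2 ≤ w) (hm : ∫⁻ x, ENNReal.ofReal (|g x| ^ q) ∂ν ≤ 1) :
    (Measure.pi fun _ : Fin n => ν) {z | (1 + 20 * q) * w ^ 2 * n ≤ ∑ i, g (z i) ^ 2} ≤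
      ENNReal.ofReal (2 * (Real.log n ^ q / (w ^ q * (n : ℝ) ^ (q / 2 - 1)))) := by
  have hn2 : (2 : ℝ) ≤ n := by exact_mod_cast hn
  have hn0 : (0 : ℝ) < n := by linarith
  have hw0 : 0 < w := by linarith
  have hl0 : 1 / 2 ≤ Real.log n := half_le_log hn2
  set l := Real.log n with hl
  have hlpos : 0 < l := by linarith
  set T := l ^ q / (w ^ q * (n : ℝ) ^ (q / 2 - 1)) with hT
  have hT0 : 0 ≤ T := by positivity
  -- Taking `H = log² n` gives `τ = w √n / log n`, for which the union bound `n τ^(-q)` over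
  -- exceedances is exactly `T`.
  set τ := 1 * w * (n / l ^ 2) ^ (1 / (2 : ℝ)) with hτ
  have hτ' : τ = w * √n / l := by
    rw [hτ, ← Real.sqrt_eq_rpow, Real.sqrt_div hn0.le, Real.sqrt_sq hlpos.le]
    ring
  have hτ0 : 0 < τ := by rw [hτ']; positivity
  have h2 := lintegral_rpow_le_one_of_le hg (a := 2) (by norm_num) hq hm
  have hA := measure_truncated_moment_le (n := n) ν hg (G := 1) (y := w) (H := l ^ 2) (a := 2)
    (c := 1 + 20 * q) one_pos hw (by positivity) le_rfl (by omega) (by linarith) hτ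
    (by simpa using h2)
  have hA' := hA.trans (ENNReal.ofReal_le_ofReal
    (rpow_neg_le_log_rpow_div hn hq hw (H := l ^ 2) (by nlinarith)))
  have hB : ∀ i : Fin n, (Measure.pi fun _ : Fin n => ν) {z | τ < |g (z i)|} ≤
      ENNReal.ofReal (1 / τ ^ q) := fun i => by
    have h3 := measure_abs_gt_le hg hτ0 (by linarith : 0 ≤ q) (I := 1) (by simpa using hm)
    have h4 := (measurePreserving_eval (fun _ : Fin n => ν) i).measure_preimage
      (s := {x | τ < |g x|}) (measurableSet_lt measurable_const (by fun_prop)).nullMeasurableSet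
    rw [← h4] at h3
    exact h3
  have hU : (Measure.pi fun _ : Fin n => ν) (⋃ i, {z | τ < |g (z i)|}) ≤ ENNReal.ofReal T := by
    refine (measure_iUnion_fintype_le _ _).trans ((Finset.sum_le_sum fun i _ => hB i).trans ?_)
    rw [Finset.sum_const, Finset.card_univ, Fintype.card_fin, nsmul_eq_mul,
      ← ENNReal.ofReal_natCast, ← ENNReal.ofReal_mul (by positivity)]
    refine ENNReal.ofReal_le_ofReal (le_of_eq ?_)
    rw [hτ', hT, Real.div_rpow (by positivity) hlpos.le, Real.mul_rpow hw0.le (by positivity),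
      Real.sqrt_eq_rpow, ← Real.rpow_mul hn0.le, Real.rpow_sub hn0, Real.rpow_one,
      show 1 / 2 * q = q / 2 by ring]
    field_simp
  have hsub : {z : Fin n → α | (1 + 20 * q) * w ^ 2 * n ≤ ∑ i, g (z i) ^ 2} ⊆
      {z | (1 + 20 * q) * (1 : ℝ) ^ (2 : ℝ) * w ^ (2 : ℝ) * n ≤
        ∑ i, if |g (z i)| ≤ τ then |g (z i)| ^ (2 : ℝ) else 0} ∪ ⋃ i, {z | τ < |g (z i)|} := by
    intro z hz
    by_cases h : ∃ i, τ < |g (z i)|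
    · exact Or.inr (Set.mem_iUnion.2 h)
    · push Not at h
      refine Or.inl ?_
      simp only [Set.mem_ofPred_eq] at hz ⊢
      simp only [h, if_true]
      simpa using hz
  refine (measure_mono hsub).trans ((measure_union_le _ _).trans ?_)
  rw [two_mul, ENNReal.ofReal_add hT0 hT0]
  exact add_le_add hA' hU

/-! ### Hölder indices, truncation levels and atypical sets -/

/-- The value `1/2 + q/4` is the midpoint of `1` and `q/2`. The strict gap `2r < q` is what makes
large noise values rare enough. -/
theorem indexR_mem {q : ℝ} (hq : 2 < q) : 1 < indexR q ∧ indexR q ≤ 2 ∧ 2 * indexR q < q := by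
  unfold indexR
  refine ⟨lt_min (by linarith) (by norm_num), min_le_right _ _, ?_⟩
  have := min_le_left (1 / 2 + q / 4) (2 : ℝ)
  linarith

theorem indexR_holderConjugate {q : ℝ} (hq : 2 < q) : (indexR q).HolderConjugate (indexR' q) :=
  Real.HolderConjugate.conjExponent (indexR_mem hq).1

theorem two_le_indexR' {q : ℝ} (hq : 2 < q) : 2 ≤ indexR' q := by
  obtain ⟨h1, h2, -⟩ := indexR_mem hq
  rw [indexR', Real.conjExponent, le_div_iff₀ (by linarith)]
  linarith

/-- The parameter `H = N (p/N)^θ` of the truncation level is thus at least `p`, so the Chernoff tail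
`u^(-cH)` survives a union over `e^(p/2)` coordinates. -/
theorem le_mul_div_rpow {N p θ : ℝ} (hp : 0 < p) (hpN : p ≤ N) (hθ : θ ≤ 1) :
    p ≤ N * (p / N) ^ θ := by
  have hN : 0 < N := hp.trans_le hpN
  have h : (p / N) ^ (1 : ℝ) ≤ (p / N) ^ θ :=
    Real.rpow_le_rpow_of_exponent_ge (by positivity) ((div_le_one hN).2 hpN) hθ
  rw [Real.rpow_one, div_le_iff₀ hN] at h
  linarith

/-- The truncation level `G y (N / p)^{θ / a}`. -/
noncomputable def truncLevel (N p G y a θ : ℝ) : ℝ := G * y * (N / (N * (p / N) ^ θ)) ^ (1 / a)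

theorem truncLevel_pos {N p G y a θ : ℝ} (hN : 0 < N) (hp : 0 < p) (hG : 0 < G) (hy : 0 < y) :
    0 < truncLevel N p G y a θ := by
  unfold truncLevel
  positivity

theorem truncLevel_rpow {N p G y a θ b : ℝ} (hN : 0 < N) (hp : 0 < p) (hG : 0 < G) (hy : 0 < y) :
    truncLevel N p G y a θ ^ b = G ^ b * y ^ b / (p / N) ^ (θ * b / a) := by
  unfold truncLevel
  rw [Real.mul_rpow (by positivity) (by positivity), Real.mul_rpow hG.le hy.le,
    ← Real.rpow_mul (by positivity),
    show N / (N * (p / N) ^ θ) = ((p / N) ^ θ)⁻¹ by field_simp,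
    Real.inv_rpow (by positivity), ← Real.rpow_mul (by positivity), ← div_eq_mul_inv]
  congr 2
  ring

/-- As `u > 2`, `e^p ≤ u^(2p)`: two units of the exponent absorb the cardinality `e^(p/2)` and still
leave `e^(-p/2)`. -/
theorem exp_half_mul_rpow_le {p u : ℝ} (hp : 0 < p) (hu : 2 < u) {b c : ℝ} (hb : b + 2 ≤ c):
    Real.exp (p / 2) * u ^ (-(c * p)) ≤ Real.exp (-p / 2) * u ^ (-(b * p)) := by
  have hu0 : 0 < u := by linarith
  rw [Real.rpow_def_of_pos hu0, Real.rpow_def_of_pos hu0, ← Real.exp_add, ← Real.exp_add]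
  refine Real.exp_le_exp.2 ?_
  have h1 := half_le_log hu.le
  have h2 : 0 ≤ (c - b - 2) * (p * Real.log u) := by
    have : 0 < p * Real.log u := by positivity
    exact mul_nonneg (by linarith) this.le
  nlinarith

theorem measure_truncated_design_le {α : Type*} [MeasurableSpace α] {n d : ℕ} (hn : 1 ≤ n)
    (ν : Measure α) [IsProbabilityMeasure ν] {x : Fin d → α → ℝ} (hx : ∀ j, Measurable (x j))
    {p u a : ℝ} (hp : 0 < p) (hpn : p ≤ n) (hd : d ≤ Real.exp (p / 2)) (hu : 2 < u) (ha : 2 ≤ a)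
    (hm : ∀ j, ∫⁻ z, ENNReal.ofReal (|x j z| ^ a) ∂ν ≤ ENNReal.ofReal (√a ^ a)) :
    (Measure.pi fun _ : Fin n => ν) {z | ∃ j, 4 * √a ^ a * u ^ a * n ≤
      ∑ i, if |x j (z i)| ≤ truncLevel n p √a u a (3 / 4) then |x j (z i)| ^ a else 0} ≤
      ENNReal.ofReal (Real.exp (-p / 2) * u ^ (-(2 * p))) := by
  have hn0 : (0 : ℝ) < n := by exact_mod_cast hn
  have hu0 : 0 < u := by linarith
  have h1 : ∀ j, (Measure.pi fun _ : Fin n => ν) {z | 4 * √a ^ a * u ^ a * n ≤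
      ∑ i, if |x j (z i)| ≤ truncLevel n p √a u a (3 / 4) then |x j (z i)| ^ a else 0} ≤
      ENNReal.ofReal (u ^ (-(6 * p))) := fun j => by
    refine (measure_truncated_moment_le ν (hx j) (by positivity) hu.le
      (H := n * (p / n) ^ (3 / 4 : ℝ)) (by positivity) ha hn (by norm_num) rfl (hm j)).trans
      (ENNReal.ofReal_le_ofReal ?_)
    refine Real.rpow_le_rpow_of_exponent_le (by linarith) ?_
    have := le_mul_div_rpow hp hpn (θ := 3 / 4) (by norm_num)
    linarith
  have hsub : {z : Fin n → α | ∃ j, 4 * √a ^ a * u ^ a * n ≤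
      ∑ i, if |x j (z i)| ≤ truncLevel n p √a u a (3 / 4) then |x j (z i)| ^ a else 0} ⊆
      ⋃ j, {z | 4 * √a ^ a * u ^ a * n ≤
      ∑ i, if |x j (z i)| ≤ truncLevel n p √a u a (3 / 4) then |x j (z i)| ^ a else 0} := by
    rintro z ⟨j, hj⟩
    exact Set.mem_iUnion.2 ⟨j, hj⟩
  refine (measure_mono hsub).trans ((measure_iUnion_fintype_le _ _).trans
    ((Finset.sum_le_sum fun j _ => h1 j).trans ?_))
  rw [Finset.sum_const, Finset.card_univ, Fintype.card_fin, nsmul_eq_mul,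
    ← ENNReal.ofReal_natCast, ← ENNReal.ofReal_mul (by positivity)]
  refine ENNReal.ofReal_le_ofReal ?_
  refine le_trans ?_ (exp_half_mul_rpow_le hp hu (b := 2) (c := 6) (by norm_num))
  gcongr

/-- Truncation at scale `min u w` gives a failure probability that is a power of this minimum. If it
equals `u`, the power is absorbed by `e^(-p/2) u^(-m)`; if it equals `w`, by the polynomial term,
because `H ≥ p ≥ 2 log n`. -/
theorem measure_truncated_noise_le {α : Type*} [MeasurableSpace α] {n : ℕ} (hn : 2 ≤ n)
    (ν : Measure α) [IsProbabilityMeasure ν] {g : α → ℝ} (hg : Measurable g)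
    {p u w q θ m : ℝ} (hp : 0 < p) (hpn : p ≤ n) (hnp : 2 * Real.log n ≤ p) (hmp : m ≤ p)
    (hu : 2 < u) (hw : 2 ≤ w) (hq : 2 < q) (hθ : θ ≤ 1)
    (hm : ∫⁻ x, ENNReal.ofReal (|g x| ^ q) ∂ν ≤ 1) :
    (Measure.pi fun _ : Fin n => ν) {z | (1 + 20 * q) * min u w ^ (2 * indexR q) * n ≤
      ∑ i, if |g (z i)| ≤ truncLevel n p 1 (min u w) (2 * indexR q) θ
        then |g (z i)| ^ (2 * indexR q) else 0} ≤
      ENNReal.ofReal (Real.exp (-p / 2) * u ^ (-m) +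
        Real.log n ^ q / (w ^ q * (n : ℝ) ^ (q / 2 - 1))) := by
  have hn2 : (2 : ℝ) ≤ n := by exact_mod_cast hn
  have hn0 : (0 : ℝ) < n := by linarith
  have hu0 : 0 < u := by linarith
  have hw0 : 0 < w := by linarith
  have hl0 : 1 / 2 ≤ Real.log n := half_le_log hn2
  obtain ⟨hr1, hr2, hrq⟩ := indexR_mem hq
  have h2 := lintegral_rpow_le_one_of_le hg (a := 2 * indexR q) (by linarith) hrq hm
  have hA := measure_truncated_moment_le (n := n) ν hg (G := 1) (y := min u w)
    (H := n * (p / n) ^ θ) (a := 2 * indexR q)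
    (c := 1 + 20 * q) one_pos (le_min hu.le hw) (by positivity) (by linarith) (by omega)
    (by linarith) (τ := truncLevel n p 1 (min u w) (2 * indexR q) θ) rfl (by simpa using h2)
  have hH := le_mul_div_rpow hp hpn hθ
  rw [Real.one_rpow, mul_one] at hA
  refine hA.trans (ENNReal.ofReal_le_ofReal ?_)
  rcases le_total u w with h | h
  · rw [min_eq_left h]
    have h3 : u ^ (-(2 * ((1 + 20 * q) - 1) * (n * (p / n) ^ θ))) ≤ u ^ (-(3 * p)) := by
      refine Real.rpow_le_rpow_of_exponent_le (by linarith) ?_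
      have : 3 * p ≤ 40 * q * p := by nlinarith
      have : 40 * q * p ≤ 40 * q * (n * (p / n) ^ θ) := by gcongr
      linarith
    have h4 := exp_half_mul_rpow_le hp hu (b := 1) (c := 3) (by norm_num)
    have h5 : u ^ (-(1 * p)) ≤ u ^ (-m) :=
      Real.rpow_le_rpow_of_exponent_le (by linarith) (by linarith)
    have h6 : u ^ (-(3 * p)) ≤ Real.exp (p / 2) * u ^ (-(3 * p)) :=
      le_mul_of_one_le_left (by positivity) (Real.one_le_exp (by positivity))
    have h7 : 0 ≤ Real.log n ^ q / (w ^ q * (n : ℝ) ^ (q / 2 - 1)) := by positivity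
    have h8 : Real.exp (-p / 2) * u ^ (-(1 * p)) ≤ Real.exp (-p / 2) * u ^ (-m) := by gcongr
    linarith
  · rw [min_eq_right h]
    have h3 := rpow_neg_le_log_rpow_div hn hq hw (H := n * (p / n) ^ θ) (by linarith)
    have h4 : 0 ≤ Real.exp (-p / 2) * u ^ (-m) := by positivity
    linarith

/-- The Hölder exponent that makes the set of atypically large values negligible. -/
noncomputable def tailExponent (q : ℝ) : ℝ := max (2 / 3) √(2 * indexR q / q)

theorem tailExponent_mem {q : ℝ} (hq : 2 < q) : 2 / 3 ≤ tailExponent q ∧ tailExponent q < 1 ∧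
    √(2 * indexR q / q) ≤ tailExponent q := by
  refine ⟨le_max_left _ _, max_lt (by norm_num) ?_, le_max_right _ _⟩
  rw [Real.sqrt_lt' one_pos, one_pow, div_lt_one (by linarith)]
  exact (indexR_mem hq).2.2

/-- Markov's inequality at order `2a` for the design, with `θ = 3/4`, gives measure `(p/N)^(3/2)`.
At order `q` for the noise, with `ρ = 2r/q` and `θ = √ρ`, it gives `(p/N)^(1/√ρ)`. Both exponents
exceed one and are at least `1 / tailExponent q`. -/
theorem real_measure_atypical_rpow_le {α : Type*} [MeasurableSpace α] (ν : Measure α)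
    [IsProbabilityMeasure ν] {f g : α → ℝ} (hf : Measurable f) (hg : Measurable g)
    {N p u y a q : ℝ} (hp : 0 < p) (hpN : p ≤ N) (hu : 2 < u) (hy : 2 ≤ y) (ha : 2 ≤ a)
    (hq : 2 < q)
    (hmf : ∫⁻ z, ENNReal.ofReal (|f z| ^ (2 * a)) ∂ν ≤ ENNReal.ofReal (√(2 * a) ^ (2 * a)))
    (hmg : ∫⁻ x, ENNReal.ofReal (|g x| ^ q) ∂ν ≤ 1) :
    N * ν.real ({x | truncLevel N p √a u a (3 / 4) < |f x|} ∪
      {x | truncLevel N p 1 y (2 * indexR q) √(2 * indexR q / q) < |g x|}) ^ tailExponent q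
        ≤ 2 * p := by
  have hN : 0 < N := hp.trans_le hpN
  have hu0 : 0 < u := by linarith
  have hy0 : 0 < y := by linarith
  have hq0 : 0 < q := by linarith
  obtain ⟨hr1, hr2, hrq⟩ := indexR_mem hq
  obtain ⟨hk0, hk1, hkr⟩ := tailExponent_mem hq
  set κ := tailExponent q with hκ
  have hκ0 : 0 < κ := by linarith
  set ρ := 2 * indexR q / q with hρ
  have hρ0 : 0 < ρ := by positivity
  have hz : 0 < p / N := by positivity
  have hz1 : p / N ≤ 1 := (div_le_one hN).2 hpN
  have h1 := measure_abs_gt_le hf (truncLevel_pos (a := a) (θ := 3 / 4) hN hp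
    (Real.sqrt_pos.2 (by linarith : 0 < a)) hu0) (by linarith : 0 ≤ 2 * a) hmf
  have h2 := measure_abs_gt_le hg (truncLevel_pos (a := 2 * indexR q) (θ := √ρ) hN hp
    one_pos hy0) hq0.le (I := 1) (by simpa using hmg)
  have b1 : √(2 * a) ^ (2 * a) / truncLevel N p √a u a (3 / 4) ^ (2 * a) ≤ (p / N) ^ (1 / κ) := by
    rw [truncLevel_rpow hN hp (Real.sqrt_pos.2 (by linarith)) hu0,
      Real.sqrt_mul (by norm_num), Real.mul_rpow (by positivity) (by positivity)]
    have e1 : √2 ^ (2 * a) ≤ u ^ (2 * a) := by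
      refine Real.rpow_le_rpow (by positivity) ?_ (by linarith)
      rw [Real.sqrt_le_left (by linarith)]
      nlinarith
    have e2 : (p / N) ^ (3 / 4 * (2 * a) / a) ≤ (p / N) ^ (1 / κ) := by
      refine Real.rpow_le_rpow_of_exponent_ge hz hz1 ?_
      rw [div_le_iff₀ hκ0, show 3 / 4 * (2 * a) / a = 3 / 2 by field_simp; norm_num]
      linarith
    have ha' : 0 < √a ^ (2 * a) := Real.rpow_pos_of_pos (Real.sqrt_pos.2 (by linarith)) _
    have hu' : 0 < u ^ (2 * a) := by positivity
    rw [div_div_eq_mul_div, div_le_iff₀ (by positivity)]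
    calc √2 ^ (2 * a) * √a ^ (2 * a) * (p / N) ^ (3 / 4 * (2 * a) / a)
        ≤ u ^ (2 * a) * √a ^ (2 * a) * (p / N) ^ (1 / κ) := by gcongr
      _ = _ := by ring
  have b2 : 1 / truncLevel N p 1 y (2 * indexR q) √ρ ^ q ≤ (p / N) ^ (1 / κ) := by
    rw [truncLevel_rpow hN hp one_pos hy0, Real.one_rpow, one_mul, one_div_div]
    have e1 : 1 ≤ y ^ q := Real.one_le_rpow (by linarith) hq0.le
    have e2 : (p / N) ^ (√ρ * q / (2 * indexR q)) ≤ (p / N) ^ (1 / κ) := by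
      refine Real.rpow_le_rpow_of_exponent_ge hz hz1 ?_
      have hs : 0 < √ρ := Real.sqrt_pos.2 hρ0
      have : √ρ * q / (2 * indexR q) = 1 / √ρ := by
        rw [eq_div_iff hs.ne', mul_comm, mul_div_assoc, ← mul_assoc]
        rw [show √ρ * √ρ = ρ from Real.mul_self_sqrt hρ0.le, hρ]
        field_simp
      rw [this]
      exact one_div_le_one_div_of_le hs hkr
    exact (div_le_self (by positivity) e1).trans e2
  have h3 : ν.real ({x | truncLevel N p √a u a (3 / 4) < |f x|} ∪
      {x | truncLevel N p 1 y (2 * indexR q) √ρ < |g x|}) ≤ 2 * (p / N) ^ (1 / κ) := by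
    have c1 := ENNReal.toReal_le_of_le_ofReal (by positivity)
      (h1.trans (ENNReal.ofReal_le_ofReal b1))
    have c2 := ENNReal.toReal_le_of_le_ofReal (by positivity)
      (h2.trans (ENNReal.ofReal_le_ofReal b2))
    refine (measureReal_union_le _ _).trans ((add_le_add c1 c2).trans (le_of_eq ?_))
    ring
  calc N * _ ≤ N * (2 * (p / N) ^ (1 / κ)) ^ κ := by gcongr
    _ = N * (2 ^ κ * (p / N)) := by
        rw [Real.mul_rpow (by norm_num) (by positivity), ← Real.rpow_mul hz.le,
          one_div_mul_cancel hκ0.ne', Real.rpow_one]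
    _ ≤ N * (2 ^ (1 : ℝ) * (p / N)) := by
        have : (2 : ℝ) ^ κ ≤ 2 ^ (1 : ℝ) :=
          Real.rpow_le_rpow_of_exponent_le (by norm_num) hk1.le
        gcongr
    _ = 2 * p := by
        rw [Real.rpow_one]
        field_simp

theorem measure_exists_sum_indicator_sq_le {α : Type*} [MeasurableSpace α] {n d : ℕ} (hn : 1 ≤ n)
    (ν : Measure α) [IsProbabilityMeasure ν] {x : Fin d → α → ℝ} (hx : ∀ j, Measurable (x j))
    {A : Fin d → Set α} (hA : ∀ j, MeasurableSet (A j)) {p η u : ℝ} (hp : 1 ≤ p) (hη : 0 < η)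
    (hη1 : η < 1) (hu : 0 < u) (hd : d ≤ Real.exp (p / 2))
    (hm : ∀ j, ∀ a : ℝ, 2 ≤ a → a ≤ 2 * p →
      ∫⁻ z, ENNReal.ofReal (|x j z| ^ a) ∂ν ≤ ENNReal.ofReal (√a ^ a))
    (hνA : ∀ j, n * ν.real (A j) ^ (1 - η) ≤ 2 * p) (hnp : 2 * Real.log n ≤ p) :
    (Measure.pi fun _ : Fin n => ν)
      {z | ∃ j, 8 / η ^ 2 * Real.exp (1 / η + 8) * u ^ 2 * p ≤
        ∑ i, (A j).indicator (fun y => x j y ^ 2) (z i)} ≤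
      ENNReal.ofReal (Real.exp (-p / 2) * u ^ (-(2 * p))) := by
  have hsub : {z : Fin n → α | ∃ j, 8 / η ^ 2 * Real.exp (1 / η + 8) * u ^ 2 * p ≤
        ∑ i, (A j).indicator (fun y => x j y ^ 2) (z i)} ⊆
      ⋃ j, {z | 8 / η ^ 2 * Real.exp (1 / η + 8) * u ^ 2 * p ≤
        ∑ i, (A j).indicator (fun y => x j y ^ 2) (z i)} := by
    rintro z ⟨j, hj⟩
    exact Set.mem_iUnion.2 ⟨j, hj⟩
  refine (measure_mono hsub).trans ((measure_iUnion_fintype_le _ _).trans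
    ((Finset.sum_le_sum fun j _ => measure_sum_indicator_sq_le hn ν (hx j) (hA j) hp hη hη1 hu
      (hm j) (hνA j) hnp).trans ?_))
  rw [Finset.sum_const, Finset.card_univ, Fintype.card_fin, nsmul_eq_mul,
    ← ENNReal.ofReal_natCast, ← ENNReal.ofReal_mul (by positivity)]
  refine ENNReal.ofReal_le_ofReal ?_
  calc (d : ℝ) * (Real.exp (-(3 * p)) * u ^ (-(2 * p)))
      ≤ Real.exp (p / 2) * (Real.exp (-(3 * p)) * u ^ (-(2 * p))) := by gcongr
    _ = Real.exp (p / 2 + -(3 * p)) * u ^ (-(2 * p)) := by rw [Real.exp_add]; ring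
    _ ≤ _ := by
        gcongr
        linarith

/-! ### Deterministic estimates for the two parts of the multiplier sum -/

theorem abs_sum_mul_mul_le {n : ℕ} {e g x : Fin n → ℝ} (he : ∀ i, |e i| ≤ 1) {G Q : ℝ}
    (hg : ∑ i, g i ^ 2 ≤ G) (hx : ∑ i, x i ^ 2 ≤ Q) :
    |∑ i, e i * (g i * x i)| ≤ √G * √Q := by
  calc |∑ i, e i * (g i * x i)| ≤ ∑ i, |e i * (g i * x i)| := Finset.abs_sum_le_sum_abs _ _
    _ ≤ ∑ i, |g i| * |x i| := by
        refine Finset.sum_le_sum fun i _ => ?_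
        rw [abs_mul, abs_mul]
        exact mul_le_of_le_one_left (by positivity) (he i)
    _ ≤ √(∑ i, |g i| ^ 2) * √(∑ i, |x i| ^ 2) := Real.sum_mul_le_sqrt_mul_sqrt _ _ _
    _ ≤ √G * √Q := by
        simp_rw [sq_abs]
        gcongr

theorem sum_sq_mul_le {n : ℕ} {g x : Fin n → ℝ} {r r' : ℝ} (hr : r.HolderConjugate r') {G Q : ℝ}
    (hg : ∑ i, |g i| ^ (2 * r) ≤ G) (hx : ∑ i, |x i| ^ (2 * r') ≤ Q) :
    ∑ i, (g i * x i) ^ 2 ≤ G ^ (1 / r) * Q ^ (1 / r') := by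
  have h := Real.inner_le_Lp_mul_Lq_of_nonneg Finset.univ hr (f := fun i => g i ^ 2)
    (g := fun i => x i ^ 2) (fun i _ => sq_nonneg _) (fun i _ => sq_nonneg _)
  have e : ∀ (y s : ℝ), (y ^ 2) ^ s = |y| ^ (2 * s) := fun y s => by
    rw [← sq_abs, ← Real.rpow_natCast, ← Real.rpow_mul (abs_nonneg _)]
    norm_num
  simp_rw [e] at h
  simp_rw [mul_pow]
  refine h.trans ?_
  have := hr.pos
  have := hr.symm.pos
  have h1 : (0 : ℝ) ≤ ∑ i, |g i| ^ (2 * r) := Finset.sum_nonneg fun i _ => by positivity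
  have h2 : (0 : ℝ) ≤ ∑ i, |x i| ^ (2 * r') := Finset.sum_nonneg fun i _ => by positivity
  have h3 : 0 ≤ G := h1.trans hg
  gcongr

theorem ae_abs_sign_le (n : ℕ) :
    ∀ᵐ e ∂(Measure.pi fun _ : Fin n => signLaw), ∀ i, |e i| ≤ 1 := by
  have := isProbabilityMeasure_signLaw
  have h : ∀ᵐ e ∂signLaw, |e| ≤ 1 := by
    rw [signLaw, ae_add_measure_iff]
    constructor
    · refine Measure.ae_smul_measure ?_ _
      rw [ae_dirac_iff (measurableSet_le (by fun_prop) measurable_const)]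
      simp
    · refine Measure.ae_smul_measure ?_ _
      rw [ae_dirac_iff (measurableSet_le (by fun_prop) measurable_const)]
      simp
  rw [ae_all_iff]
  intro i
  exact (measurePreserving_eval (fun _ : Fin n => signLaw) i).quasiMeasurePreserving.ae h

theorem measure_preimage_snd {β γ : Type*} [MeasurableSpace β] [MeasurableSpace γ]
    (σ : Measure β) [IsProbabilityMeasure σ] (μ : Measure γ) [SFinite μ] (S : Set γ) :
    σ.prod μ {x | x.2 ∈ S} = μ S := by
  have : {x : β × γ | x.2 ∈ S} = Set.univ ×ˢ S := by
    ext x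
    simp
  rw [this, Measure.prod_prod, measure_univ, one_mul]

/-- The constant of `measure_sum_indicator_sq_le` at `η = 1 - tailExponent q`. -/
noncomputable def designConst (q : ℝ) : ℝ :=
  8 / (1 - tailExponent q) ^ 2 * Real.exp (1 / (1 - tailExponent q) + 8)

/-- The first term serves the atypical points, the second the typical ones; the last one makes the
constant positive for every real `q`. -/
noncomputable def multiplierConst (q : ℝ) : ℝ :=
  √((1 + 20 * q) * designConst q) + 2 * √((1 + 20 * q) * (8 * indexR' q)) + 1

theorem multiplierConst_pos (q : ℝ) : 0 < multiplierConst q := by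
  unfold multiplierConst
  positivity

theorem multiplierConst_mul (q b c e : ℝ) : multiplierConst q * b * c * e =
    √((1 + 20 * q) * designConst q) * b * c * e +
      2 * √((1 + 20 * q) * (8 * indexR' q)) * b * c * e + b * c * e := by
  unfold multiplierConst
  ring

theorem heavy_part_le {n : ℕ} {p q u w : ℝ} (hu : 0 < u) (hw : 0 < w) (hq : 2 < q) :
    √((1 + 20 * q) * w ^ 2 * n) * √(designConst q * u ^ 2 * p) =
      √((1 + 20 * q) * designConst q) * (u * w) * √n * √p := by
  have hD : 0 ≤ designConst q := by unfold designConst; positivity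
  have hC : 0 ≤ 1 + 20 * q := by linarith
  rw [Real.sqrt_mul (by positivity), Real.sqrt_mul hC, Real.sqrt_mul (by positivity),
    Real.sqrt_mul hD, Real.sqrt_mul hC, Real.sqrt_sq hu.le, Real.sqrt_sq hw.le]
  ring

/-- The Hoeffding level is at most `(2v + 1) √p`, and the Hölder factor is proportional to `y u`
with `y = min u w`. Using `y ≤ u` against `v` and `y ≤ w` against `1` yields `u² v + u w`; scaling
the noise by `u` or by `w` alone would not give both. -/
theorem light_part_le {n d : ℕ} {p q u v w : ℝ} (hn : 0 < n) (hp : 0 ≤ p) (hu : 2 < u)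
    (hv : 0 < v) (hw : 2 ≤ w) (hq : 2 < q) (hd : Real.log d ≤ p / 2) :
    √(2 * (2 * v ^ 2 * p + Real.log d)) *
      √(((1 + 20 * q) * min u w ^ (2 * indexR q) * n) ^ (1 / indexR q) *
        (4 * √(2 * indexR' q) ^ (2 * indexR' q) * u ^ (2 * indexR' q) * n) ^ (1 / indexR' q)) ≤
      2 * √((1 + 20 * q) * (8 * indexR' q)) * (u * w + u ^ 2 * v) * √n * √p := by
  have hu0 : 0 < u := by linarith
  have hw0 : 0 < w := by linarith
  have hn0 : (0 : ℝ) < n := by exact_mod_cast hn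
  have hr := indexR_holderConjugate hq
  have hr0 := hr.pos
  have hr0' := hr.symm.pos
  have hr2 := two_le_indexR' hq
  have hC : 1 ≤ 1 + 20 * q := by linarith
  set y := min u w with hy
  have hy0 : 0 < y := lt_min hu0 hw0
  have e0 : ∀ (z : ℝ) {r : ℝ}, 0 ≤ z → 0 < r → (z ^ (2 * r)) ^ (1 / r) = z ^ 2 := by
    intro z r hz hr
    rw [← Real.rpow_mul hz, show 2 * r * (1 / r) = ((2 : ℕ) : ℝ) by field_simp; norm_num,
      Real.rpow_natCast]
  have e1 : ∀ (z : ℝ) {r : ℝ}, 1 ≤ z → 1 ≤ r → z ^ (1 / r) ≤ z := by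
    intro z r hz hr
    calc z ^ (1 / r) ≤ z ^ (1 : ℝ) := Real.rpow_le_rpow_of_exponent_le hz
          ((div_le_one (by linarith)).2 hr)
      _ = z := Real.rpow_one z
  have hprod : ((1 + 20 * q) * y ^ (2 * indexR q) * n) ^ (1 / indexR q) *
      (4 * √(2 * indexR' q) ^ (2 * indexR' q) * u ^ (2 * indexR' q) * n) ^ (1 / indexR' q) ≤
      ((1 + 20 * q) * (8 * indexR' q)) * (y * u) ^ 2 * n := by
    rw [Real.mul_rpow (by positivity) hn0.le, Real.mul_rpow (by positivity) (by positivity),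
      e0 y hy0.le hr0, Real.mul_rpow (by positivity) hn0.le,
      Real.mul_rpow (by positivity) (by positivity), e0 u hu0.le hr0',
      Real.mul_rpow (by positivity) (by positivity), e0 _ (Real.sqrt_nonneg _) hr0',
      Real.sq_sqrt (by positivity)]
    have hnn : (n : ℝ) ^ (1 / indexR q) * (n : ℝ) ^ (1 / indexR' q) = n := by
      rw [← Real.rpow_add hn0, hr.one_div_add_one_div, div_one, Real.rpow_one]
    calc (1 + 20 * q) ^ (1 / indexR q) * y ^ 2 * (n : ℝ) ^ (1 / indexR q) *
          (4 ^ (1 / indexR' q) * (2 * indexR' q) * u ^ 2 * (n : ℝ) ^ (1 / indexR' q))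
        = (1 + 20 * q) ^ (1 / indexR q) * 4 ^ (1 / indexR' q) * (2 * indexR' q) * (y * u) ^ 2 *
          ((n : ℝ) ^ (1 / indexR q) * (n : ℝ) ^ (1 / indexR' q)) := by ring
      _ ≤ (1 + 20 * q) * 4 * (2 * indexR' q) * (y * u) ^ 2 * n := by
          rw [hnn]
          gcongr
          · exact e1 _ hC hr.lt.le
          · exact e1 _ (by norm_num) hr.symm.lt.le
      _ = _ := by ring
  have hs : √(2 * (2 * v ^ 2 * p + Real.log d)) ≤ (2 * v + 1) * √p := by
    rw [Real.sqrt_le_left (by positivity), mul_pow, Real.sq_sqrt hp]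
    nlinarith [mul_nonneg hv.le hp]
  have hR : √(((1 + 20 * q) * (8 * indexR' q)) * (y * u) ^ 2 * n) =
      √((1 + 20 * q) * (8 * indexR' q)) * (y * u) * √n := by
    rw [Real.sqrt_mul (by positivity), Real.sqrt_mul (by positivity),
      Real.sqrt_sq (by positivity)]
  have hyu : (2 * v + 1) * (y * u) ≤ 2 * (u * w + u ^ 2 * v) := by
    have h1 : y * u ≤ u * u := mul_le_mul_of_nonneg_right (min_le_left _ _) hu0.le
    have h2 : y * u ≤ w * u := mul_le_mul_of_nonneg_right (min_le_right _ _) hu0.le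
    nlinarith [mul_le_mul_of_nonneg_left h1 hv.le, mul_pos hu0 hw0]
  calc _ ≤ ((2 * v + 1) * √p) * (√((1 + 20 * q) * (8 * indexR' q)) * (y * u) * √n) := by
        rw [← hR]
        exact mul_le_mul hs (Real.sqrt_le_sqrt hprod) (Real.sqrt_nonneg _) (by positivity)
    _ = √((1 + 20 * q) * (8 * indexR' q)) * √n * √p * ((2 * v + 1) * (y * u)) := by ring
    _ ≤ √((1 + 20 * q) * (8 * indexR' q)) * √n * √p * (2 * (u * w + u ^ 2 * v)) := by gcongr
    _ = _ := by ring

/-! ### Deviation of the normalised multiplier sum -/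

section

variable {α : Type*} [MeasurableSpace α] {n d : ℕ} (ν : Measure α) [IsProbabilityMeasure ν]
  {x : Fin d → α → ℝ} {g : α → ℝ} {p q u v w m : ℝ}

/-- When `p` exceeds `n`, every point may count as atypical: the smallness condition `n ν(A)^(1-η) ≤
2p` holds even for the whole space, and Cauchy–Schwarz alone suffices. -/
theorem measure_multiplier_gt_le_of_lt (hx : ∀ j, Measurable (x j)) (hg : Measurable g)
    (hn : 2 ≤ n) (hp : 1 ≤ p) (hnp : 2 * Real.log n ≤ p) (hd : d ≤ Real.exp (p / 2))
    (hmx : ∀ j, ∀ a : ℝ, 2 ≤ a → a ≤ 2 * p →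
      ∫⁻ z, ENNReal.ofReal (|x j z| ^ a) ∂ν ≤ ENNReal.ofReal (√a ^ a))
    (hmg : ∫⁻ z, ENNReal.ofReal (|g z| ^ q) ∂ν ≤ 1)
    (hq : 2 < q) (hu : 2 < u) (hv : 0 < v) (hw : 2 ≤ w) (hpn : n < p) :
    ((Measure.pi fun _ : Fin n => signLaw).prod (Measure.pi fun _ : Fin n => ν))
      {ω | ∃ j, multiplierConst q * (u * w + u ^ 2 * v) * √n * √p <
        |∑ i, ω.1 i * (g (ω.2 i) * x j (ω.2 i))|} ≤
      ENNReal.ofReal (Real.exp (-p / 2) * u ^ (-(2 * p)) +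
        2 * (Real.log n ^ q / (w ^ q * (n : ℝ) ^ (q / 2 - 1)))) := by
  have := isProbabilityMeasure_signLaw
  have hu0 : 0 < u := by linarith
  have hw0 : 0 < w := by linarith
  obtain ⟨hk0, hk1, -⟩ := tailExponent_mem hq
  have hl0 : 1 / 2 ≤ Real.log n := half_le_log (by exact_mod_cast hn)
  have hT0 : 0 ≤ Real.log n ^ q / (w ^ q * (n : ℝ) ^ (q / 2 - 1)) := by positivity
  have h1 := measure_exists_sum_indicator_sq_le (n := n) (by omega) ν hx
    (A := fun _ => Set.univ) (fun _ => MeasurableSet.univ) (η := 1 - tailExponent q) hp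
    (by linarith) (by linarith) hu0 hd hmx (fun j => by
      rw [probReal_univ, Real.one_rpow]
      linarith) hnp
  have h2 := measure_sum_sq_noise_le hn ν hg hq hw hmg
  have h3 := (ae_iff.1 (ae_abs_sign_le n))
  obtain ⟨B₁, hB₁, h1⟩ : ∃ B : Set (Fin n → α), (∀ z ∉ B, ∀ j,
      ∑ i, x j (z i) ^ 2 ≤ designConst q * u ^ 2 * p) ∧ (Measure.pi fun _ : Fin n => ν) B ≤
      ENNReal.ofReal (Real.exp (-p / 2) * u ^ (-(2 * p))) := by
    refine ⟨_, fun z hz j => ?_, h1⟩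
    by_contra! h
    exact hz ⟨j, by simpa [designConst] using h.le⟩
  obtain ⟨B₂, hB₂, h2⟩ : ∃ B : Set (Fin n → α), (∀ z ∉ B,
      ∑ i, g (z i) ^ 2 ≤ (1 + 20 * q) * w ^ 2 * n) ∧ (Measure.pi fun _ : Fin n => ν) B ≤
      ENNReal.ofReal (2 * (Real.log n ^ q / (w ^ q * (n : ℝ) ^ (q / 2 - 1)))) :=
    ⟨_, fun z hz => (not_le.1 hz).le, h2⟩
  have hsub : {ω : (Fin n → ℝ) × (Fin n → α) |
      ∃ j, multiplierConst q * (u * w + u ^ 2 * v) * √n * √p <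
        |∑ i, ω.1 i * (g (ω.2 i) * x j (ω.2 i))|} ⊆
      {ω | ω.2 ∈ B₁} ∪ {ω | ω.2 ∈ B₂} ∪ {e | ¬ ∀ i, |e i| ≤ 1} ×ˢ Set.univ := by
    rintro ω ⟨j, hj⟩
    by_contra hω
    simp only [Set.mem_union, Set.mem_ofPred_eq, Set.mem_prod, Set.mem_univ, and_true, not_or,
      not_not] at hω
    obtain ⟨⟨hω1, hω2⟩, hω3⟩ := hω
    have h := abs_sum_mul_mul_le hω3 (hB₂ _ hω2) (hB₁ _ hω1 j)
    rw [heavy_part_le hu0 hw0 hq] at h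
    have h8 : √((1 + 20 * q) * designConst q) * (u * w) * √n * √p ≤
        √((1 + 20 * q) * designConst q) * (u * w + u ^ 2 * v) * √n * √p := by
      refine mul_le_mul_of_nonneg_right (mul_le_mul_of_nonneg_right
        (mul_le_mul_of_nonneg_left ?_ (Real.sqrt_nonneg _)) (Real.sqrt_nonneg _))
        (Real.sqrt_nonneg _)
      have : 0 ≤ u ^ 2 * v := by positivity
      linarith
    have h9 : 0 ≤ (u * w + u ^ 2 * v) * √n * √p := by positivity
    have h10 : 0 ≤ 2 * √((1 + 20 * q) * (8 * indexR' q)) * (u * w + u ^ 2 * v) * √n * √p := by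
      positivity
    rw [multiplierConst_mul] at hj
    linarith
  refine (measure_mono hsub).trans ((measure_union_le _ _).trans ?_)
  rw [Measure.prod_prod, h3, zero_mul, add_zero,
    ENNReal.ofReal_add (by positivity) (by positivity)]
  refine (measure_union_le _ _).trans (add_le_add ?_ ?_)
  · rwa [measure_preimage_snd]
  · rwa [measure_preimage_snd]

theorem measure_multiplier_gt_le_of_le (hx : ∀ j, Measurable (x j)) (hg : Measurable g)
    (hn : 2 ≤ n) (hp : 1 ≤ p) (hnp : 2 * Real.log n ≤ p) (hd : d ≤ Real.exp (p / 2))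
    (hrp : 4 * indexR' q ≤ 2 * p)
    (hmx : ∀ j, ∀ a : ℝ, 2 ≤ a → a ≤ 2 * p →
      ∫⁻ z, ENNReal.ofReal (|x j z| ^ a) ∂ν ≤ ENNReal.ofReal (√a ^ a))
    (hmg : ∫⁻ z, ENNReal.ofReal (|g z| ^ q) ∂ν ≤ 1)
    (hq : 2 < q) (hu : 2 < u) (hv : 0 < v) (hw : 2 ≤ w) (hpn : p ≤ n) (hmp : m ≤ p) :
    ((Measure.pi fun _ : Fin n => signLaw).prod (Measure.pi fun _ : Fin n => ν))
      {ω | ∃ j, multiplierConst q * (u * w + u ^ 2 * v) * √n * √p <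
        |∑ i, ω.1 i * (g (ω.2 i) * x j (ω.2 i))|} ≤
      ENNReal.ofReal (Real.exp (-p / 2) * u ^ (-(2 * p)) + 2 * (Real.exp (-p / 2) * u ^ (-m)) +
        3 * (Real.log n ^ q / (w ^ q * (n : ℝ) ^ (q / 2 - 1))) +
        2 * Real.exp (-(2 * v ^ 2 * p))) := by
  have := isProbabilityMeasure_signLaw
  have hp0 : 0 < p := by linarith
  have hu0 : 0 < u := by linarith
  have hw0 : 0 < w := by linarith
  have hq0 : 0 < q := by linarith
  have hn0 : (0 : ℝ) < n := hp0.trans_le hpn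
  obtain ⟨hk0, hk1, -⟩ := tailExponent_mem hq
  obtain ⟨hr1, hr2, hrq⟩ := indexR_mem hq
  have hr' := two_le_indexR' hq
  have hl0 : 1 / 2 ≤ Real.log n := half_le_log (by exact_mod_cast hn)
  have hT0 : 0 ≤ Real.log n ^ q / (w ^ q * (n : ℝ) ^ (q / 2 - 1)) := by positivity
  set y := min u w with hy
  have hy2 : 2 ≤ y := le_min hu.le hw
  set τx := truncLevel n p √(2 * indexR' q) u (2 * indexR' q) (3 / 4) with hτx
  set τg := truncLevel n p 1 y (2 * indexR q) √(2 * indexR q / q) with hτg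
  set A : Fin d → Set α := fun j => {z | τx < |x j z|} ∪ {z | τg < |g z|} with hA
  have hAm : ∀ j, MeasurableSet (A j) := fun j =>
    (measurableSet_lt measurable_const (by fun_prop)).union
      (measurableSet_lt measurable_const (by fun_prop))
  have hνA : ∀ j, n * ν.real (A j) ^ (1 - (1 - tailExponent q)) ≤ 2 * p := fun j => by
    rw [sub_sub_cancel]
    exact real_measure_atypical_rpow_le ν (hx j) hg hp0 hpn hu hy2 (by linarith) hq
      (hmx j _ (by linarith) (by linarith)) hmg
  have h1 := measure_exists_sum_indicator_sq_le (n := n) (by omega) ν hx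
    hAm (η := 1 - tailExponent q) hp (by linarith) (by linarith) hu0 hd hmx hνA hnp
  have h2 := measure_sum_sq_noise_le hn ν hg hq hw hmg
  have h3 := (ae_iff.1 (ae_abs_sign_le n))
  have h4 := measure_truncated_design_le (n := n) (by omega) ν hx hp0 hpn hd hu
    (a := 2 * indexR' q) (by linarith) (fun j => hmx j _ (by linarith) (by linarith))
  have hρ : √(2 * indexR q / q) ≤ 1 := by
    rw [Real.sqrt_le_left one_pos.le, one_pow]
    exact (div_le_one hq0).2 hrq.le
  have h5 := measure_truncated_noise_le hn ν hg hp0 hpn hnp hmp hu hw hq hρ hmg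
  set cx : Fin d → α → ℝ := fun j z => if |x j z| ≤ τx then x j z else 0 with hcx
  set cg : α → ℝ := fun z => if |g z| ≤ τg then g z else 0 with hcg
  have hcxm : ∀ j, Measurable (cx j) := fun j =>
    Measurable.ite (measurableSet_le (by fun_prop) measurable_const) (hx j) measurable_const
  have hcgm : Measurable cg :=
    Measurable.ite (measurableSet_le (by fun_prop) measurable_const) hg measurable_const
  -- The term `log d` cancels the union over `d` coordinates and leaves probability `2 exp(-2 v²
  -- p)`.
  set s := √(2 * (2 * v ^ 2 * p + Real.log d)) with hs
  have hlogd : 0 ≤ Real.log d := Real.log_natCast_nonneg d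
  have h6 := measure_exists_abs_sign_sum_gt_le (Measure.pi fun _ : Fin n => ν)
    (b := fun (j : Fin d) i z => cg (z i) * cx j (z i))
    (fun j i => (hcgm.comp (measurable_pi_apply i)).mul ((hcxm j).comp (measurable_pi_apply i)))
    (Real.sqrt_nonneg _ : 0 ≤ s)
  have h6' : 2 * d * Real.exp (-(s ^ 2 / 2)) ≤ 2 * Real.exp (-(2 * v ^ 2 * p)) := by
    rcases Nat.eq_zero_or_pos d with hd0 | hd0
    · simp only [hd0, Nat.cast_zero]
      rw [mul_zero, zero_mul]
      positivity
    · have hd0' : (0 : ℝ) < d := by exact_mod_cast hd0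
      rw [hs, Real.sq_sqrt (by positivity), show -(2 * (2 * v ^ 2 * p + Real.log d) / 2) =
        -(2 * v ^ 2 * p) - Real.log d by ring, Real.exp_sub, Real.exp_log hd0']
      apply le_of_eq
      field_simp
  have h6 := h6.trans (ENNReal.ofReal_le_ofReal h6')
  have hd' : Real.log d ≤ p / 2 := by
    rcases Nat.eq_zero_or_pos d with hd0 | hd0
    · rw [hd0, Nat.cast_zero, Real.log_zero]
      linarith
    · rwa [Real.log_le_iff_le_exp (by exact_mod_cast hd0)]
  obtain ⟨B₁, hB₁, h1⟩ : ∃ B : Set (Fin n → α), (∀ z ∉ B, ∀ j,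
      ∑ i, (A j).indicator (x j) (z i) ^ 2 ≤ designConst q * u ^ 2 * p) ∧
      (Measure.pi fun _ : Fin n => ν) B ≤
      ENNReal.ofReal (Real.exp (-p / 2) * u ^ (-(2 * p))) := by
    refine ⟨_, fun z hz j => ?_, h1⟩
    by_contra! h
    refine hz ⟨j, le_trans h.le (Finset.sum_le_sum fun i _ => ?_)⟩
    by_cases hi : z i ∈ A j <;> simp [hi]
  obtain ⟨B₂, hB₂, h2⟩ : ∃ B : Set (Fin n → α), (∀ z ∉ B,
      ∑ i, g (z i) ^ 2 ≤ (1 + 20 * q) * w ^ 2 * n) ∧ (Measure.pi fun _ : Fin n => ν) B ≤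
      ENNReal.ofReal (2 * (Real.log n ^ q / (w ^ q * (n : ℝ) ^ (q / 2 - 1)))) :=
    ⟨_, fun z hz => (not_le.1 hz).le, h2⟩
  obtain ⟨B₄, hB₄, h4⟩ : ∃ B : Set (Fin n → α), (∀ z ∉ B, ∀ j,
      ∑ i, |cx j (z i)| ^ (2 * indexR' q) ≤
        4 * √(2 * indexR' q) ^ (2 * indexR' q) * u ^ (2 * indexR' q) * n) ∧
      (Measure.pi fun _ : Fin n => ν) B ≤
      ENNReal.ofReal (Real.exp (-p / 2) * u ^ (-(2 * p))) := by
    refine ⟨_, fun z hz j => ?_, h4⟩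
    by_contra! h
    refine hz ⟨j, le_trans h.le (Finset.sum_le_sum fun i _ => ?_)⟩
    simp only [hcx, ← hτx]
    split_ifs
    · exact le_rfl
    · rw [abs_zero, Real.zero_rpow (by linarith)]
  obtain ⟨B₅, hB₅, h5⟩ : ∃ B : Set (Fin n → α), (∀ z ∉ B,
      ∑ i, |cg (z i)| ^ (2 * indexR q) ≤ (1 + 20 * q) * y ^ (2 * indexR q) * n) ∧
      (Measure.pi fun _ : Fin n => ν) B ≤
      ENNReal.ofReal (Real.exp (-p / 2) * u ^ (-m) +
        Real.log n ^ q / (w ^ q * (n : ℝ) ^ (q / 2 - 1))) := by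
    refine ⟨_, fun z hz => le_trans (Finset.sum_le_sum fun i _ => ?_) (not_le.1 hz).le, h5⟩
    simp only [hcg, ← hτg, ← hy]
    split_ifs
    · exact le_rfl
    · rw [abs_zero, Real.zero_rpow (by linarith)]
  obtain ⟨B₆, hB₆, h6⟩ : ∃ B : Set ((Fin n → ℝ) × (Fin n → α)), (∀ ω ∉ B, ∀ j,
      |∑ i, ω.1 i * (cg (ω.2 i) * cx j (ω.2 i))| ≤ s * √(∑ i, (cg (ω.2 i) * cx j (ω.2 i)) ^ 2)) ∧
      ((Measure.pi fun _ : Fin n => signLaw).prod (Measure.pi fun _ : Fin n => ν)) B ≤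
      ENNReal.ofReal (2 * Real.exp (-(2 * v ^ 2 * p))) := by
    refine ⟨_, fun ω hω j => ?_, h6⟩
    by_contra! h
    exact hω ⟨j, h⟩
  have hsub : {ω : (Fin n → ℝ) × (Fin n → α) |
      ∃ j, multiplierConst q * (u * w + u ^ 2 * v) * √n * √p <
        |∑ i, ω.1 i * (g (ω.2 i) * x j (ω.2 i))|} ⊆
      {ω | ω.2 ∈ B₁} ∪ {ω | ω.2 ∈ B₂} ∪ {ω | ω.2 ∈ B₄} ∪ {ω | ω.2 ∈ B₅} ∪ B₆ ∪
        {e | ¬ ∀ i, |e i| ≤ 1} ×ˢ Set.univ := by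
    rintro ω ⟨j, hj⟩
    by_contra hω
    simp only [Set.mem_union, Set.mem_ofPred_eq, Set.mem_prod, Set.mem_univ, and_true, not_or,
      not_not] at hω
    obtain ⟨⟨⟨⟨⟨hω1, hω2⟩, hω4⟩, hω5⟩, hω6⟩, hω3⟩ := hω
    have hheavy := abs_sum_mul_mul_le hω3 (hB₂ _ hω2) (hB₁ _ hω1 j)
    rw [heavy_part_le hu0 hw0 hq] at hheavy
    have hlight := (hB₆ _ hω6 j).trans ((mul_le_mul_of_nonneg_left (Real.sqrt_le_sqrt
      (sum_sq_mul_le (indexR_holderConjugate hq) (hB₅ _ hω5) (hB₄ _ hω4 j)))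
      (Real.sqrt_nonneg _)).trans (light_part_le (by omega) hp0.le hu hv hw hq hd'))
    have hsplit : ∑ i, ω.1 i * (g (ω.2 i) * x j (ω.2 i)) =
        ∑ i, ω.1 i * (g (ω.2 i) * (A j).indicator (x j) (ω.2 i)) +
          ∑ i, ω.1 i * (cg (ω.2 i) * cx j (ω.2 i)) := by
      rw [← Finset.sum_add_distrib]
      refine Finset.sum_congr rfl fun i _ => ?_
      by_cases hi : ω.2 i ∈ A j
      -- At an atypical point at least one truncated factor vanishes, so the point contributes to
      -- the heavy sum only.
      · have : cg (ω.2 i) * cx j (ω.2 i) = 0 := by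
          rcases hi with h | h
          · simp only [hcx, if_neg (not_le.2 (Set.mem_ofPred.1 h)), mul_zero]
          · simp only [hcg, if_neg (not_le.2 (Set.mem_ofPred.1 h)), zero_mul]
        rw [this, Set.indicator_of_mem hi]
        ring
      · rw [Set.indicator_of_notMem hi]
        simp only [hA, Set.mem_union, Set.mem_ofPred_eq, not_or, not_lt] at hi
        simp only [hcg, hcx, if_pos hi.1, if_pos hi.2]
        ring
    rw [hsplit] at hj
    have h7 := abs_add_le (∑ i, ω.1 i * (g (ω.2 i) * (A j).indicator (x j) (ω.2 i)))
      (∑ i, ω.1 i * (cg (ω.2 i) * cx j (ω.2 i)))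
    have h8 : √((1 + 20 * q) * designConst q) * (u * w) * √n * √p ≤
        √((1 + 20 * q) * designConst q) * (u * w + u ^ 2 * v) * √n * √p := by
      refine mul_le_mul_of_nonneg_right (mul_le_mul_of_nonneg_right
        (mul_le_mul_of_nonneg_left ?_ (Real.sqrt_nonneg _)) (Real.sqrt_nonneg _))
        (Real.sqrt_nonneg _)
      have : 0 ≤ u ^ 2 * v := by positivity
      linarith
    have h9 : 0 ≤ (u * w + u ^ 2 * v) * √n * √p := by positivity
    rw [multiplierConst_mul] at hj
    linarith
  have hmono : Real.exp (-p / 2) * u ^ (-(2 * p)) ≤ Real.exp (-p / 2) * u ^ (-m) := by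
    gcongr
    · linarith
    · linarith
  refine (measure_mono hsub).trans ((measure_union_le _ _).trans ?_)
  rw [Measure.prod_prod, h3, zero_mul, add_zero]
  have hE : 0 ≤ Real.exp (-p / 2) * u ^ (-m) := by positivity
  have h4' := h4.trans (ENNReal.ofReal_le_ofReal hmono)
  set E₁ := Real.exp (-p / 2) * u ^ (-(2 * p)) with hE₁
  set E₂ := Real.exp (-p / 2) * u ^ (-m) with hE₂
  set T := Real.log n ^ q / (w ^ q * (n : ℝ) ^ (q / 2 - 1)) with hT
  have hE₁0 : 0 ≤ E₁ := by positivity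
  -- Order of the exceptional sets: atypical squares `E₁`, noise squares `2T`, truncated design
  -- `E₂`, truncated noise `E₂ + T`, Hoeffding.
  rw [show E₁ + 2 * E₂ + 3 * T + 2 * Real.exp (-(2 * v ^ 2 * p)) =
    E₁ + 2 * T + E₂ + (E₂ + T) + 2 * Real.exp (-(2 * v ^ 2 * p)) by ring,
    ENNReal.ofReal_add (by positivity) (by positivity),
    ENNReal.ofReal_add (by positivity) (by positivity),
    ENNReal.ofReal_add (by positivity) (by positivity),
    ENNReal.ofReal_add (by positivity) (by positivity)]
  refine (measure_union_le _ _).trans (add_le_add ((measure_union_le _ _).trans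
    (add_le_add ((measure_union_le _ _).trans (add_le_add ((measure_union_le _ _).trans
    (add_le_add ?_ ?_)) ?_)) ?_)) h6)
  all_goals rwa [measure_preimage_snd]

end

/-! ### Expected maximum of sign sums -/

/-- Allows a maximum of several `V_j` to be replaced by `K` plus a sum of `k`-th powers, which are
small in mean once `K` is a large enough constant. -/
theorem le_add_pow_div {V K : ℝ} (hV : 0 ≤ V) (hK : 0 < K) {k : ℕ} (hk : 1 ≤ k) :
    V ≤ K + V ^ k / K ^ (k - 1) := by
  rcases le_total V K with h | h
  · have : 0 ≤ V ^ k / K ^ (k - 1) := by positivity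
    linarith
  · have h1 : V ≤ V ^ k / K ^ (k - 1) := by
      rw [le_div_iff₀ (by positivity)]
      calc V * K ^ (k - 1) ≤ V * V ^ (k - 1) := by gcongr
        _ = V ^ k := by rw [← pow_succ', Nat.sub_add_cancel hk]
    linarith

/-- A deterministic form of the sub-Gaussian maximal inequality. -/
theorem abs_le_exp_add_sq {S V s D : ℝ} (hs : 0 < s) (hD : 0 < D) :
    |S| ≤ (Real.log D + (Real.exp (s * S - s ^ 2 * V / 2) + Real.exp (-s * S - s ^ 2 * V / 2)) / D) / s
      + s / 2 * V := by
  have h : ∀ z : ℝ, z ≤ Real.log D + Real.exp z / D := fun z => by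
    have := Real.add_one_le_exp (z - Real.log D)
    rw [Real.exp_sub, Real.exp_log hD] at this
    linarith
  have e1 := (Real.exp_pos (s * S - s ^ 2 * V / 2)).le
  have e2 := (Real.exp_pos (-s * S - s ^ 2 * V / 2)).le
  have h3 : s * |S| ≤ Real.log D + (Real.exp (s * S - s ^ 2 * V / 2) +
      Real.exp (-s * S - s ^ 2 * V / 2)) / D + s ^ 2 * V / 2 := by
    have d1 : 0 ≤ Real.exp (s * S - s ^ 2 * V / 2) / D := by positivity
    have d2 : 0 ≤ Real.exp (-s * S - s ^ 2 * V / 2) / D := by positivity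
    have h1 := h (s * S - s ^ 2 * V / 2)
    have h2 := h (-s * S - s ^ 2 * V / 2)
    rw [add_div]
    rcases abs_cases S with ⟨h4, -⟩ | ⟨h4, -⟩ <;> rw [h4] <;> linarith
  calc |S| = s * |S| / s := by field_simp
    _ ≤ (Real.log D + (Real.exp (s * S - s ^ 2 * V / 2) +
      Real.exp (-s * S - s ^ 2 * V / 2)) / D + s ^ 2 * V / 2) / s := by gcongr
    _ = _ := by field_simp

section

variable {α : Type*} [MeasurableSpace α] {n d : ℕ} (ν : Measure α) [IsProbabilityMeasure ν]

theorem lintegral_sum_sq_pow_le {f : α → ℝ} (hf : Measurable f) {k : ℕ} {κ : ℝ} (hn : 1 ≤ n)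
    (hκ : 0 < κ) (hkn : k ≤ κ * n)
    (hm : ∀ s : ℕ, 1 ≤ s → s ≤ k →
      ∫⁻ x, ENNReal.ofReal (|f x| ^ (2 * s : ℝ)) ∂ν ≤
        ENNReal.ofReal (√(2 * s : ℝ) ^ (2 * s : ℝ))) :
    ∫⁻ z, ENNReal.ofReal ((∑ i, f (z i) ^ 2) ^ k) ∂(Measure.pi fun _ : Fin n => ν) ≤
      ENNReal.ofReal ((4 * Real.exp 1 * (1 + κ) * n) ^ k * Real.exp k) := by
  have hn0 : (0 : ℝ) < n := by exact_mod_cast hn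
  -- With `δ = k / n` the factor `exp (n δ)` is just `e^k`. The `1 + κ` in `D` keeps `k / ((1 + κ)
  -- n)` below one, so its `s`-th power is at most `k / n`.
  have h := lintegral_sum_pow_le (n := n) ν (W := fun x => f x ^ 2) (by fun_prop)
    (fun x => sq_nonneg _) (k := k) (D := 4 * Real.exp 1 * (1 + κ) * n) (δ := k / n)
    (by positivity) (by positivity) (fun s hs hk => ?_)
  · rwa [mul_div_cancel₀ _ hn0.ne'] at h
  have hs0 : (0 : ℝ) < s := by exact_mod_cast hs
  have hsk : (s : ℝ) ≤ k := by exact_mod_cast hk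
  have hk0 : (0 : ℝ) < k := by linarith
  have e1 : ∀ x, (f x ^ 2) ^ s = |f x| ^ (2 * s : ℝ) := fun x => by
    rw [← sq_abs, ← pow_mul, ← Real.rpow_natCast]
    push_cast
    rfl
  simp_rw [e1]
  refine (mul_le_mul_right (hm s hs hk) _).trans ?_
  rw [← ENNReal.ofReal_natCast, ← ENNReal.ofReal_mul (by positivity)]
  refine ENNReal.ofReal_le_ofReal ?_
  have e2 : √(2 * s : ℝ) ^ (2 * s : ℝ) = (2 * k : ℝ) ^ s * (s / k : ℝ) ^ s := by
    rw [Real.sqrt_eq_rpow, ← Real.rpow_mul (by positivity), ← mul_pow, ← Real.rpow_natCast]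
    congr 1 <;> field_simp
  have hz : (k : ℝ) / ((1 + κ) * n) ≤ 1 := by
    rw [div_le_one (by positivity)]
    linarith
  calc (k.choose s : ℝ) * √(2 * s : ℝ) ^ (2 * s : ℝ)
      = (2 * k : ℝ) ^ s * ((k.choose s : ℝ) * (s / k : ℝ) ^ s) := by rw [e2]; ring
    _ ≤ (2 * k : ℝ) ^ s * Real.exp s := by
        gcongr
        exact choose_mul_div_pow_le hs hk
    _ = (4 * Real.exp 1 * (1 + κ) * n / 2) ^ s * (k / ((1 + κ) * n)) ^ s := by
        rw [show Real.exp s = Real.exp 1 ^ s by rw [← Real.exp_nat_mul, mul_one], ← mul_pow,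
          ← mul_pow]
        congr 1
        field_simp
        ring
    _ ≤ (4 * Real.exp 1 * (1 + κ) * n / 2) ^ s * (k / n) := by
        gcongr
        calc ((k : ℝ) / ((1 + κ) * n)) ^ s ≤ k / ((1 + κ) * n) :=
              pow_le_of_le_one (by positivity) hz (by omega)
          _ ≤ k / n := by
              gcongr
              nlinarith

/-- Expected maximum of normalised sign sums of a random vector with few sub-Gaussian moments. -/
theorem lintegral_iSup_sign_sum_le {x : Fin d → α → ℝ} (hx : ∀ j, Measurable (x j)) {p κ : ℝ}
    (hn : 1 ≤ n) (hd : 2 ≤ d) (hκ : 0 < κ) (hpn : p ≤ κ * n) (hdp : Real.log d + 1 ≤ p)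
    (hmx : ∀ j, ∀ a : ℝ, 2 ≤ a → a ≤ 2 * p →
      ∫⁻ z, ENNReal.ofReal (|x j z| ^ a) ∂ν ≤ ENNReal.ofReal (√a ^ a)) :
    ∫⁻ ω, ENNReal.ofReal (⨆ j, |1 / √n * ∑ i, ω.1 i * x j (ω.2 i)|)
      ∂((Measure.pi fun _ : Fin n => signLaw).prod (Measure.pi fun _ : Fin n => ν)) ≤
      ENNReal.ofReal ((4 + 4 * Real.exp 1 ^ 3 * (1 + κ)) * √(Real.log d)) := by
  have := isProbabilityMeasure_signLaw
  have hd2 : (2 : ℝ) ≤ d := by exact_mod_cast hd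
  have hd0 : (0 : ℝ) < d := by linarith
  have hn0 : (0 : ℝ) < n := by exact_mod_cast hn
  have hl : 1 / 2 ≤ Real.log d := half_le_log hd2
  have hne : Nonempty (Fin d) := ⟨⟨0, by omega⟩⟩
  -- This `s` balances `log (2d) / s` against `s V`.
  set s := √(Real.log d) with hs
  have hs0 : 0 < s := Real.sqrt_pos.2 (by linarith)
  have hs2 : s ^ 2 = Real.log d := Real.sq_sqrt (by linarith)
  set k := ⌈Real.log d⌉₊ with hk
  have hk1 : 1 ≤ k := Nat.one_le_ceil_iff.2 (by linarith)
  have hkl : Real.log d ≤ k := Nat.le_ceil _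
  have hkp : (k : ℝ) ≤ p := by
    have := Nat.ceil_lt_add_one (by linarith : 0 ≤ Real.log d)
    linarith
  set K' := 4 * Real.exp 1 * (1 + κ) with hK'
  -- The integral of `V_j^k` is at most `(K' e)^k = K^k e^(-k) ≤ K^k / d`, so the sum over `j` costs
  -- no more than `K` itself.
  set K := K' * Real.exp 1 ^ 2 with hK
  have hK'0 : 0 < K' := by positivity
  have hK0 : 0 < K := by positivity
  set σμ := (Measure.pi fun _ : Fin n => signLaw).prod (Measure.pi fun _ : Fin n => ν) with hσμ
  set V : Fin d → (Fin n → α) → ℝ := fun j z => ∑ i, (x j (z i) / √n) ^ 2 with hV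
  set S : Fin d → (Fin n → ℝ) × (Fin n → α) → ℝ :=
    fun j ω => ∑ i, ω.1 i * (x j (ω.2 i) / √n) with hS
  have hxm : ∀ j (i : Fin n), Measurable fun z : Fin n → α => x j (z i) := fun j i =>
    (hx j).comp (measurable_pi_apply i)
  have hxm2 : ∀ j (i : Fin n), Measurable fun ω : (Fin n → ℝ) × (Fin n → α) => x j (ω.2 i) :=
    fun j i => (hxm j i).comp measurable_snd
  have hV0 : ∀ j z, 0 ≤ V j z := fun j z => Finset.sum_nonneg fun i _ => sq_nonneg _
  have hVm : ∀ j, Measurable (V j) := fun j => by fun_prop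
  have hSm : ∀ j, Measurable (S j) := fun j => by fun_prop
  have hE : ∀ j (t : ℝ), t ^ 2 = s ^ 2 →
      ∫⁻ ω, ENNReal.ofReal (Real.exp (t * S j ω - s ^ 2 * V j ω.2 / 2)) ∂σμ ≤ 1 := fun j t ht => by
    have h := lintegral_exp_sign_sum_le (Measure.pi fun _ : Fin n => ν)
      (c := fun i z => t * (x j (z i) / √n)) (fun i => ((hxm j i).div_const _).const_mul _)
    refine le_trans (le_of_eq ?_) h
    refine lintegral_congr fun ω => ?_
    congr 2
    simp only [hS, hV, mul_pow, ht]
    rw [Finset.mul_sum, Finset.mul_sum]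
    congr 1
    refine Finset.sum_congr rfl fun i _ => ?_
    ring
  have hVk : ∀ j, ∫⁻ ω : (Fin n → ℝ) × (Fin n → α), ENNReal.ofReal (V j ω.2 ^ k) ∂σμ ≤
      ENNReal.ofReal ((K' * Real.exp 1) ^ k) := fun j => by
    have h := lintegral_sum_sq_pow_le (n := n) ν (hx j) (k := k) hn hκ (by linarith)
      (fun s hs hk => by
        have hs1 : (1 : ℝ) ≤ s := by exact_mod_cast hs
        have hsk : (s : ℝ) ≤ k := by exact_mod_cast hk
        exact hmx j _ (by linarith) (by linarith))
    have e1 : ∀ z, V j z ^ k = (1 / n : ℝ) ^ k * (∑ i, x j (z i) ^ 2) ^ k := fun z => by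
      rw [← mul_pow]
      congr 1
      simp only [hV, div_pow, Real.sq_sqrt hn0.le]
      rw [← Finset.sum_div]
      ring
    have e2 : ∫⁻ ω : (Fin n → ℝ) × (Fin n → α), ENNReal.ofReal (V j ω.2 ^ k) ∂σμ =
        ∫⁻ z, ENNReal.ofReal (V j z ^ k) ∂(Measure.pi fun _ : Fin n => ν) :=
      measurePreserving_snd.lintegral_comp (f := fun z => ENNReal.ofReal (V j z ^ k))
        (by fun_prop)
    rw [e2]
    simp_rw [e1, ENNReal.ofReal_mul (by positivity : (0 : ℝ) ≤ (1 / n : ℝ) ^ k)]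
    rw [lintegral_const_mul _ (by fun_prop)]
    refine (mul_le_mul_right h _).trans ?_
    rw [← ENNReal.ofReal_mul (by positivity)]
    refine ENNReal.ofReal_le_ofReal (le_of_eq ?_)
    rw [show Real.exp k = Real.exp 1 ^ k by rw [← Real.exp_nat_mul, mul_one], ← mul_pow, ← mul_pow]
    congr 1
    field_simp
    exact hK'.symm
  set c := s / 2 * (1 / K ^ (k - 1)) with hc
  set e := 1 / (2 * d) / s with he
  have hc0 : 0 ≤ c := by positivity
  have he0 : 0 ≤ e := by positivity
  set A := Real.log (2 * d) / s + s / 2 * K with hA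
  have hA0 : 0 ≤ A := by
    have : 0 ≤ Real.log (2 * d) := Real.log_nonneg (by linarith)
    positivity
  have hpt : ∀ ω : (Fin n → ℝ) × (Fin n → α),
      (⨆ j, |1 / √n * ∑ i, ω.1 i * x j (ω.2 i)|) ≤ A + ∑ j,
        (e * Real.exp (s * S j ω - s ^ 2 * V j ω.2 / 2) +
        e * Real.exp (-s * S j ω - s ^ 2 * V j ω.2 / 2) + c * V j ω.2 ^ k) := fun ω => by
    refine ciSup_le fun j => ?_
    have h1 : 1 / √n * ∑ i, ω.1 i * x j (ω.2 i) = S j ω := by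
      simp only [hS]
      rw [Finset.mul_sum]
      refine Finset.sum_congr rfl fun i _ => ?_
      ring
    rw [h1]
    have h2 := abs_le_exp_add_sq (S := S j ω) (V := V j ω.2) hs0 (by positivity : (0 : ℝ) < 2 * d)
    have h3 := mul_le_mul_of_nonneg_left (le_add_pow_div (hV0 j ω.2) hK0 hk1)
      (by positivity : 0 ≤ s / 2)
    have h4 := Finset.single_le_sum (f := fun j =>
        (e * Real.exp (s * S j ω - s ^ 2 * V j ω.2 / 2) +
        e * Real.exp (-s * S j ω - s ^ 2 * V j ω.2 / 2) + c * V j ω.2 ^ k)) (fun j _ => by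
          have := hV0 j ω.2
          positivity) (Finset.mem_univ j)
    refine h2.trans (le_trans ?_ (add_le_add_right h4 _))
    refine (add_le_add_right h3 _).trans (le_of_eq ?_)
    simp only [hA, he, hc]
    ring
  have hint : ∀ j, ∫⁻ ω, (ENNReal.ofReal e *
      ENNReal.ofReal (Real.exp (s * S j ω - s ^ 2 * V j ω.2 / 2)) + ENNReal.ofReal e *
      ENNReal.ofReal (Real.exp (-s * S j ω - s ^ 2 * V j ω.2 / 2)) +
      ENNReal.ofReal c * ENNReal.ofReal (V j ω.2 ^ k)) ∂σμ ≤
      ENNReal.ofReal (e + e + c * (K' * Real.exp 1) ^ k) := fun j => by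
    rw [lintegral_add_left (by fun_prop), lintegral_add_left (by fun_prop),
      lintegral_const_mul _ (by fun_prop), lintegral_const_mul _ (by fun_prop),
      lintegral_const_mul _ (by fun_prop), ENNReal.ofReal_add (by positivity) (by positivity),
      ENNReal.ofReal_add he0 he0, ENNReal.ofReal_mul hc0]
    gcongr
    · exact mul_le_of_le_one_right' (hE j s rfl)
    · exact mul_le_of_le_one_right' (hE j (-s) (by ring))
    · exact hVk j
  calc _ ≤ ∫⁻ ω, (ENNReal.ofReal A + ∑ j, (ENNReal.ofReal e *
        ENNReal.ofReal (Real.exp (s * S j ω - s ^ 2 * V j ω.2 / 2)) + ENNReal.ofReal e *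
        ENNReal.ofReal (Real.exp (-s * S j ω - s ^ 2 * V j ω.2 / 2)) +
        ENNReal.ofReal c * ENNReal.ofReal (V j ω.2 ^ k))) ∂σμ := by
        refine lintegral_mono fun ω => (ENNReal.ofReal_le_ofReal (hpt ω)).trans (le_of_eq ?_)
        have hnn : ∀ j, 0 ≤ V j ω.2 ^ k := fun j => pow_nonneg (hV0 j _) _
        rw [ENNReal.ofReal_add hA0 (Finset.sum_nonneg fun j _ => by
          have := hnn j
          positivity), ENNReal.ofReal_sum_of_nonneg (fun j _ => by
          have := hnn j
          positivity)]
        congr 1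
        refine Finset.sum_congr rfl fun j _ => ?_
        have := hnn j
        rw [ENNReal.ofReal_add (by positivity) (by positivity),
          ENNReal.ofReal_add (by positivity) (by positivity), ENNReal.ofReal_mul he0,
          ENNReal.ofReal_mul he0, ENNReal.ofReal_mul hc0]
    _ ≤ ENNReal.ofReal A + ∑ _j : Fin d, ENNReal.ofReal (e + e + c * (K' * Real.exp 1) ^ k) := by
        rw [lintegral_add_left measurable_const, lintegral_finsetSum _ (fun j _ => by fun_prop)]
        simp only [lintegral_const, measure_univ, mul_one]
        gcongr with j
        exact hint j
    _ ≤ _ := by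
        rw [Finset.sum_const, Finset.card_univ, Fintype.card_fin, nsmul_eq_mul,
          ← ENNReal.ofReal_natCast, ← ENNReal.ofReal_mul (by positivity),
          ← ENNReal.ofReal_add hA0 (by positivity)]
        refine ENNReal.ofReal_le_ofReal ?_
        have h1 : d * (c * (K' * Real.exp 1) ^ k) ≤ s / 2 * K := by
          have h2 : (K' * Real.exp 1) ^ k * Real.exp 1 ^ k = K ^ k := by
            rw [← mul_pow, hK]
            congr 1
            ring
          have h3 : (d : ℝ) ≤ Real.exp 1 ^ k := by
            rw [← Real.exp_nat_mul, mul_one, ← Real.log_le_iff_le_exp hd0]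
            exact hkl
          have h4 : K ^ k = K * K ^ (k - 1) := by rw [← pow_succ', Nat.sub_add_cancel hk1]
          calc d * (c * (K' * Real.exp 1) ^ k)
              ≤ Real.exp 1 ^ k * (c * (K' * Real.exp 1) ^ k) := by gcongr
            _ = c * ((K' * Real.exp 1) ^ k * Real.exp 1 ^ k) := by ring
            _ = s / 2 * K := by
                rw [h2, h4, hc]
                field_simp
        have h5 : Real.log (2 * d) + 1 ≤ 4 * s ^ 2 := by
          rw [hs2, Real.log_mul (by norm_num) hd0.ne']
          have := Real.log_two_lt_d9
          have := Real.log_two_gt_d9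
          have := Real.log_le_log (by norm_num) hd2
          linarith
        have h6 : d * (e + e) = 1 / s := by
          rw [he]
          field_simp
          norm_num
        have h7 : (Real.log (2 * d) + 1) / s ≤ 4 * s := by
          rw [div_le_iff₀ hs0]
          linarith
        have h8 : K = 4 * Real.exp 1 ^ 3 * (1 + κ) := by
          rw [hK, hK']
          ring
        rw [← h8]
        rw [add_div] at h7
        calc A + d * (e + e + c * (K' * Real.exp 1) ^ k)
            = A + d * (e + e) + d * (c * (K' * Real.exp 1) ^ k) := by ring
          _ ≤ Real.log (2 * d) / s + s / 2 * K + 1 / s + s / 2 * K := by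
              rw [h6, hA]
              linarith
          _ ≤ _ := by linarith

end

/-! ### Transfer to the original sample -/

theorem normL_nonneg {Ω : Type*} [MeasurableSpace Ω] {P : Measure Ω} {p : ℝ} {Z : Ω → ℝ} :
    0 ≤ normL P p Z :=
  lpNorm_nonneg

theorem lintegral_div_rpow_le_of_normL_le {Ω : Type*} [MeasurableSpace Ω] {P : Measure Ω}
    {f : Ω → ℝ} {a B c : ℝ} (ha : 0 < a) (hc : 0 < c) (hf : MemLp f (ENNReal.ofReal a) P)
    (hB : normL P a f ≤ B) :
    ∫⁻ ω, ENNReal.ofReal (|f ω / c| ^ a) ∂P ≤ ENNReal.ofReal ((B / c) ^ a) := by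
  have ha0 : ENNReal.ofReal a ≠ 0 := by simpa using ha
  have hB0 : 0 ≤ B := le_trans lpNorm_nonneg hB
  have h1 := ofReal_lpNorm hf
  rw [eLpNorm_eq_lintegral_rpow_enorm_toReal ha0 ENNReal.ofReal_ne_top,
    ENNReal.toReal_ofReal ha.le] at h1
  have h2 : ∫⁻ ω, ‖f ω‖ₑ ^ a ∂P = ENNReal.ofReal (normL P a f) ^ a := by
    rw [normL, h1, ← ENNReal.rpow_mul, one_div_mul_cancel ha.ne', ENNReal.rpow_one]
  have h3 : ∀ ω, ENNReal.ofReal (|f ω / c| ^ a) = ‖f ω‖ₑ ^ a * ENNReal.ofReal ((1 / c) ^ a) := by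
    intro ω
    rw [← ofReal_norm, Real.norm_eq_abs, ENNReal.ofReal_rpow_of_nonneg (abs_nonneg _) ha.le,
      ← ENNReal.ofReal_mul (by positivity), ← Real.mul_rpow (abs_nonneg _) (by positivity),
      abs_div, abs_of_pos hc, mul_one_div]
  simp_rw [h3]
  rw [lintegral_mul_const' _ _ ENNReal.ofReal_ne_top, h2,
    ENNReal.ofReal_rpow_of_nonneg normL_nonneg ha.le, ← ENNReal.ofReal_mul
    (Real.rpow_nonneg normL_nonneg _), ← Real.mul_rpow normL_nonneg (by positivity), mul_one_div]
  refine ENNReal.ofReal_le_ofReal (Real.rpow_le_rpow ?_ (by gcongr) ha.le)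
  exact div_nonneg normL_nonneg hc.le

theorem integrable_and_integral_le {Ω : Type*} [MeasurableSpace Ω] {P : Measure Ω}
    {f : Ω → ℝ} {B : ℝ} (hf : AEStronglyMeasurable f P) (h0 : ∀ ω, 0 ≤ f ω) (hB : 0 ≤ B)
    (h : ∫⁻ ω, ENNReal.ofReal (f ω) ∂P ≤ ENNReal.ofReal B) :
    Integrable f P ∧ ∫ ω, f ω ∂P ≤ B := by
  refine ⟨⟨hf, ?_⟩, ?_⟩
  · rw [hasFiniteIntegral_iff_ofReal (Filter.Eventually.of_forall h0)]
    exact h.trans_lt ENNReal.ofReal_lt_top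
  · rw [integral_eq_lintegral_of_nonneg_ae (Filter.Eventually.of_forall h0) hf]
    exact ENNReal.toReal_le_of_le_ofReal hB h

theorem one_sub_le_measureReal {Ω : Type*} [MeasurableSpace Ω] {P : Measure Ω}
    [IsProbabilityMeasure P] {S B : Set Ω} {b : ℝ} (hb : 0 ≤ b) (hS : Bᶜ ⊆ S)
    (hB : P B ≤ ENNReal.ofReal b) : 1 - b ≤ P.real S := by
  have h1 : P.real B ≤ b := ENNReal.toReal_le_of_le_ofReal hb hB
  have h2 : (1 : ℝ) ≤ P.real S + P.real B := by
    rw [← probReal_univ (μ := P)]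
    refine le_trans (measureReal_mono ?_) (measureReal_union_le S B)
    intro ω _
    by_cases h : ω ∈ B
    · exact Or.inr h
    · exact Or.inl (hS h)
  linarith

section

variable {Ω₀ Ω : Type*} [MeasurableSpace Ω₀] [MeasurableSpace Ω] {P₀ : Measure Ω₀} {P : Measure Ω}
  {N d : ℕ} {X₀ : Ω₀ → Fin d → ℝ} {ξ₀ : Ω₀ → ℝ} {X : Fin N → Ω → Fin d → ℝ} {ξ ε : Fin N → Ω → ℝ}

theorem SignedSample.aemeasurable_sign (S : SignedSample P₀ P X₀ ξ₀ X ξ ε) (i : Fin N) :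
    AEMeasurable (ε i) P := by
  have := isProbabilityMeasure_signLaw
  -- The image of a measure under a function that is not a.e. measurable is `0` by convention, so
  -- prescribing a nonzero law forces measurability.
  refine AEMeasurable.of_map_ne_zero ?_
  rw [S.signs i]
  exact IsProbabilityMeasure.ne_zero _

theorem SignedSample.aemeasurable_joint (S : SignedSample P₀ P X₀ ξ₀ X ξ ε) :
    AEMeasurable (fun ω => ((fun i => ε i ω), fun i => (X i ω, ξ i ω))) P :=
  (aemeasurable_pi_lambda _ S.aemeasurable_sign).prodMk
    (aemeasurable_pi_lambda _ fun i => (S.copies i).aemeasurable_fst)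

theorem SignedSample.map_joint [IsProbabilityMeasure P] (S : SignedSample P₀ P X₀ ξ₀ X ξ ε) :
    P.map (fun ω => ((fun i => ε i ω), fun i => (X i ω, ξ i ω))) =
      (Measure.pi fun _ : Fin N => signLaw).prod
        (Measure.pi fun _ : Fin N => P₀.map fun ω => (X₀ ω, ξ₀ ω)) := by
  have h1 := (indepFun_iff_map_prod_eq_prod_map_map
    (aemeasurable_pi_lambda _ S.aemeasurable_sign)
    (aemeasurable_pi_lambda _ fun i => (S.copies i).aemeasurable_fst)).1 S.indep
  have h2 := (iIndepFun_iff_map_fun_eq_pi_map S.aemeasurable_sign).1 S.indep_signs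
  have h3 := (iIndepFun_iff_map_fun_eq_pi_map fun i => (S.copies i).aemeasurable_fst).1
    S.indep_copies
  rw [h1, h2, h3]
  congr 2
  · funext i
    exact S.signs i
  · funext i
    exact (S.copies i).map_eq

theorem normL_two_le_maxNormL2 (j : Fin d) :
    normL P₀ 2 (fun ω => X₀ ω j) ≤ maxNormL2 P₀ X₀ :=
  le_ciSup (f := fun j : Fin d => normL P₀ 2 (fun ω => X₀ ω j)) (Set.finite_range _).bddAbove j

theorem maxNormL2_nonneg : 0 ≤ maxNormL2 P₀ X₀ :=
  Real.iSup_nonneg fun _ => lpNorm_nonneg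

variable {a₀ a₁ κ t L q : ℝ}

theorem LimitedMoments.sixteen_le (H : LimitedMoments P₀ a₀ a₁ κ N d t L q X₀ ξ₀) :
    16 ≤ t * Real.log N ∧ 8 * indexR' q ≤ t * Real.log N := by
  have h1 := H.index_le
  have h2 := two_le_indexR' H.two_lt
  have h3 : (2 : ℝ) ≤ max 2 (1 + a₀ / a₁) := le_max_left _ _
  constructor <;> nlinarith

theorem LimitedMoments.two_le_size (H : LimitedMoments P₀ a₀ a₁ κ N d t L q X₀ ξ₀) : 2 ≤ N := by
  have h1 := H.sixteen_le.1
  by_contra! h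
  have : (N : ℝ) ≤ 1 := by exact_mod_cast (by omega : N ≤ 1)
  have h2 : Real.log N ≤ 0 := Real.log_nonpos (by positivity) this
  nlinarith [H.four_le]

theorem LimitedMoments.log_le (H : LimitedMoments P₀ a₀ a₁ κ N d t L q X₀ ξ₀) :
    Real.log N ≤ Real.log d := by
  have := H.two_le_size
  exact Real.log_le_log (by exact_mod_cast (by omega : 0 < N)) (by exact_mod_cast H.card_le)

theorem LimitedMoments.bounds (H : LimitedMoments P₀ a₀ a₁ κ N d t L q X₀ ξ₀) :
    16 ≤ t * Real.log d ∧ 8 * indexR' q ≤ t * Real.log d ∧ 4 * Real.log d ≤ t * Real.log d := by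
  obtain ⟨h1, h2⟩ := H.sixteen_le
  have h3 := H.log_le
  have h4 := H.four_le
  have h5 : t * Real.log N ≤ t * Real.log d := by gcongr
  have h6 : 0 ≤ Real.log d := Real.log_natCast_nonneg d
  exact ⟨by linarith, by linarith, by gcongr⟩

/-- The moment condition at order `2` with `L ≤ 0` would force every coordinate norm to vanish.
Division by `L * maxNormL2 P₀ X₀` is therefore legitimate outside the degenerate case. -/
theorem LimitedMoments.pos_of_maxNormL2_pos (H : LimitedMoments P₀ a₀ a₁ κ N d t L q X₀ ξ₀)
    (hM : 0 < maxNormL2 P₀ X₀) : 0 < L := by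
  by_contra! hL
  refine absurd hM (not_lt.2 (Real.iSup_le (fun j => ?_) le_rfl))
  have h1 := (H.moments j 2 le_rfl (by linarith [H.bounds.1])).2
  have h2 : (0 : ℝ) ≤ √2 * normL P₀ 2 (fun ω => X₀ ω j) :=
    mul_nonneg (Real.sqrt_nonneg _) lpNorm_nonneg
  nlinarith

theorem LimitedMoments.lintegral_design_le (H : LimitedMoments P₀ a₀ a₁ κ N d t L q X₀ ξ₀)
    (hX : AEMeasurable (fun ω => (X₀ ω, ξ₀ ω)) P₀) (hM : 0 < maxNormL2 P₀ X₀) (j : Fin d) {a : ℝ}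
    (ha : 2 ≤ a) (hat : a ≤ t * Real.log d) :
    ∫⁻ z, ENNReal.ofReal (|z.1 j / (L * maxNormL2 P₀ X₀)| ^ a)
      ∂(P₀.map fun ω => (X₀ ω, ξ₀ ω)) ≤ ENNReal.ofReal (√a ^ a) := by
  have hL := H.pos_of_maxNormL2_pos hM
  rw [lintegral_map' (by fun_prop) hX]
  obtain ⟨h1, h2⟩ := H.moments j a ha hat
  have h3 : normL P₀ a (fun ω => X₀ ω j) ≤ L * √a * maxNormL2 P₀ X₀ :=
    h2.trans (by gcongr; exact normL_two_le_maxNormL2 j)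
  have h4 := lintegral_div_rpow_le_of_normL_le (by linarith) (mul_pos hL hM) h1 h3
  rwa [show L * √a * maxNormL2 P₀ X₀ / (L * maxNormL2 P₀ X₀) = √a by field_simp] at h4

theorem LimitedMoments.lintegral_noise_le (H : LimitedMoments P₀ a₀ a₁ κ N d t L q X₀ ξ₀)
    (hX : AEMeasurable (fun ω => (X₀ ω, ξ₀ ω)) P₀) (hξ : 0 < normL P₀ q ξ₀) :
    ∫⁻ z, ENNReal.ofReal (|z.2 / normL P₀ q ξ₀| ^ q) ∂(P₀.map fun ω => (X₀ ω, ξ₀ ω)) ≤ 1 := by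
  rw [lintegral_map' (by fun_prop) hX]
  have h := lintegral_div_rpow_le_of_normL_le (by linarith [H.two_lt]) hξ H.noise le_rfl
  rwa [div_self hξ.ne', Real.one_rpow, ENNReal.ofReal_one] at h

theorem SignedSample.ae_design_eq_zero (S : SignedSample P₀ P X₀ ξ₀ X ξ ε)
    (H : LimitedMoments P₀ a₀ a₁ κ N d t L q X₀ ξ₀) (hM : maxNormL2 P₀ X₀ = 0) :
    ∀ᵐ ω ∂P, ∀ i j, X i ω j = 0 := by
  rw [ae_all_iff]
  intro i
  rw [ae_all_iff]
  intro j
  have h1 : normL P₀ 2 (fun ω => X₀ ω j) = 0 :=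
    le_antisymm (hM ▸ normL_two_le_maxNormL2 j) lpNorm_nonneg
  have h2 := (lpNorm_eq_zero (H.moments j 2 le_rfl (by linarith [H.bounds.1])).1 (by simp)).1 h1
  exact (S.copies i).symm.ae_snd (p := fun z => z.1 j = 0)
    (measurableSet_eq_fun (by fun_prop) measurable_const) h2

theorem SignedSample.ae_noise_eq_zero (S : SignedSample P₀ P X₀ ξ₀ X ξ ε)
    (H : LimitedMoments P₀ a₀ a₁ κ N d t L q X₀ ξ₀) (hξ : normL P₀ q ξ₀ = 0) :
    ∀ᵐ ω ∂P, ∀ i, ξ i ω = 0 := by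
  rw [ae_all_iff]
  intro i
  have hq : ENNReal.ofReal q ≠ 0 := by
    simpa using (by linarith [H.two_lt] : 0 < q)
  have h2 := (lpNorm_eq_zero H.noise hq).1 hξ
  exact (S.copies i).symm.ae_snd (p := fun z => z.2 = 0)
    (measurableSet_eq_fun (by fun_prop) measurable_const) h2

variable [IsProbabilityMeasure P₀] [IsProbabilityMeasure P]

theorem SignedSample.integral_iSup_sign_sum_le (S : SignedSample P₀ P X₀ ξ₀ X ξ ε)
    (H : LimitedMoments P₀ a₀ a₁ κ N d t L q X₀ ξ₀) (hκ : 0 < κ) :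
    Integrable (fun ω => ⨆ j : Fin d, |1 / √(N : ℝ) * ∑ i, ε i ω * X i ω j|) P ∧
      ∫ ω, (⨆ j : Fin d, |1 / √(N : ℝ) * ∑ i, ε i ω * X i ω j|) ∂P ≤
        (4 + 4 * Real.exp 1 ^ 3 * (1 + κ)) * √(Real.log d) * L * maxNormL2 P₀ X₀ := by
  have hN := H.two_le_size
  have hd : 2 ≤ d := hN.trans H.card_le
  rcases (maxNormL2_nonneg (P₀ := P₀) (X₀ := X₀)).eq_or_lt with hM | hM
  · have h0 : (fun ω => ⨆ j : Fin d, |1 / √(N : ℝ) * ∑ i, ε i ω * X i ω j|) =ᵐ[P] 0 := by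
      filter_upwards [S.ae_design_eq_zero H hM.symm] with ω hω
      simp [hω]
    rw [integral_congr_ae h0, ← hM]
    refine ⟨(integrable_zero _ _ _).congr h0.symm, ?_⟩
    simp
  · have hL := H.pos_of_maxNormL2_pos hM
    set D := L * maxNormL2 P₀ X₀ with hD
    have hD0 : 0 < D := mul_pos hL hM
    have hX : AEMeasurable (fun ω => (X₀ ω, ξ₀ ω)) P₀ :=
      (S.copies ⟨0, by omega⟩).aemeasurable_snd
    set Φ : Ω → (Fin N → ℝ) × (Fin N → (Fin d → ℝ) × ℝ) :=
      fun ω => ((fun i => ε i ω), fun i => (X i ω, ξ i ω)) with hΦ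
    have hΦm : AEMeasurable Φ P := S.aemeasurable_joint
    have : IsProbabilityMeasure (P₀.map fun ω => (X₀ ω, ξ₀ ω)) := Measure.isProbabilityMeasure_map hX
    set G : (Fin N → ℝ) × (Fin N → (Fin d → ℝ) × ℝ) → ℝ :=
      fun ω => ⨆ j, |1 / √(N : ℝ) * ∑ i, ω.1 i * ((ω.2 i).1 j / D)| with hG
    have hGm : Measurable G := Measurable.iSup fun j => by fun_prop
    obtain ⟨b1, -, b3⟩ := H.bounds
    have h1 := lintegral_iSup_sign_sum_le (n := N) (P₀.map fun ω => (X₀ ω, ξ₀ ω))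
      (x := fun j z => z.1 j / D) (fun j => by fun_prop) (p := t * Real.log d / 2)
      (by omega) hd hκ (by linarith [H.order_le]) (by linarith)
      (fun j a ha hat => H.lintegral_design_le hX hM j ha (by linarith))
    rw [← S.map_joint] at h1
    obtain ⟨h2, h3⟩ := integrable_and_integral_le (f := G) hGm.aestronglyMeasurable
      (fun ω => Real.iSup_nonneg fun j => abs_nonneg _) (by positivity) h1
    have h4 : (fun ω => ⨆ j : Fin d, |1 / √(N : ℝ) * ∑ i, ε i ω * X i ω j|) =
        fun ω => D * G (Φ ω) := by
      funext ω
      simp only [hG, hΦ]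
      rw [Real.mul_iSup_of_nonneg hD0.le]
      congr 1
      funext j
      conv_rhs => rw [← abs_of_pos hD0, ← abs_mul, abs_of_pos hD0]
      congr 1
      rw [mul_left_comm, Finset.mul_sum (a := D)]
      congr 1
      refine Finset.sum_congr rfl fun i _ => ?_
      field_simp
    rw [h4]
    refine ⟨(h2.comp_aemeasurable hΦm).const_mul D, ?_⟩
    rw [integral_const_mul, ← integral_map hΦm hGm.aestronglyMeasurable]
    calc D * ∫ ω, G ω ∂(P.map Φ) ≤ D * ((4 + 4 * Real.exp 1 ^ 3 * (1 + κ)) * √(Real.log d)) := by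
          gcongr
      _ = _ := by
          rw [hD]
          ring

theorem SignedSample.le_measureReal_multiplier (S : SignedSample P₀ P X₀ ξ₀ X ξ ε)
    (H : LimitedMoments P₀ a₀ a₁ κ N d t L q X₀ ξ₀) {u v w p m : ℝ} (hu : 2 < u) (hv : 0 < v)
    (hw : 2 ≤ w) (hp : p = t * Real.log d / 2) (hm : m = p / Real.log (Real.exp 1 * N / p)) :
    1 - Real.exp (-p / 2) / u ^ (2 * p) - 4 * Real.exp (-p / 2) / u ^ (1 * m)
        - 3 * Real.log N ^ q / (w ^ q * (N : ℝ) ^ (q / 2 - 1))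
        - 2 * Real.exp (-(v ^ 2 * t * Real.log d))
      ≤ P.real {ω | (⨆ j : Fin d, |∑ i, ε i ω * ξ i ω * X i ω j|)
          ≤ multiplierConst q * (u * w + u ^ 2 * v) * L * normL P₀ q ξ₀ * √(N : ℝ)
            * √(t * Real.log d) * maxNormL2 P₀ X₀} := by
  have hN := H.two_le_size
  have hd : 2 ≤ d := hN.trans H.card_le
  have hq := H.two_lt
  have hu0 : 0 < u := by linarith
  have hw0 : 0 < w := by linarith
  obtain ⟨b1, b2, b3⟩ := H.bounds
  have hN0 : (0 : ℝ) < N := by exact_mod_cast (by omega : 0 < N)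
  have hd0 : (0 : ℝ) < d := by exact_mod_cast (by omega : 0 < d)
  have hl0 : 1 / 2 ≤ Real.log N := half_le_log (by exact_mod_cast hN)
  set T := Real.log N ^ q / (w ^ q * (N : ℝ) ^ (q / 2 - 1)) with hT
  have hT0 : 0 ≤ T := by positivity
  set E₁ := Real.exp (-p / 2) * u ^ (-(2 * p)) with hE₁
  set E₂ := Real.exp (-p / 2) * u ^ (-m) with hE₂
  have hE₁0 : 0 ≤ E₁ := by positivity
  have hE₂0 : 0 ≤ E₂ := by positivity
  have hE₃0 : 0 ≤ 2 * Real.exp (-(2 * v ^ 2 * p)) := by positivity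
  have hlhs : 1 - Real.exp (-p / 2) / u ^ (2 * p) - 4 * Real.exp (-p / 2) / u ^ (1 * m)
        - 3 * Real.log N ^ q / (w ^ q * (N : ℝ) ^ (q / 2 - 1))
        - 2 * Real.exp (-(v ^ 2 * t * Real.log d)) =
      1 - (E₁ + 4 * E₂ + 3 * T + 2 * Real.exp (-(2 * v ^ 2 * p))) := by
    rw [hE₁, hE₂, hT, Real.rpow_neg hu0.le, Real.rpow_neg hu0.le, one_mul,
      show 2 * v ^ 2 * p = v ^ 2 * t * Real.log d by rw [hp]; ring]
    ring
  rw [hlhs]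
  -- Degenerate case: if the design or the noise vanishes almost surely, both sides of the event are
  -- zero and no normalisation is possible or needed.
  have hdeg : (∀ᵐ ω ∂P, ∀ i j, ξ i ω * X i ω j = 0) → L * normL P₀ q ξ₀ * maxNormL2 P₀ X₀ = 0 →
      1 - (E₁ + 4 * E₂ + 3 * T + 2 * Real.exp (-(2 * v ^ 2 * p))) ≤
      P.real {ω | (⨆ j : Fin d, |∑ i, ε i ω * ξ i ω * X i ω j|)
          ≤ multiplierConst q * (u * w + u ^ 2 * v) * L * normL P₀ q ξ₀ * √(N : ℝ)
            * √(t * Real.log d) * maxNormL2 P₀ X₀} := by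
    intro h0 h1
    refine one_sub_le_measureReal (B := {ω | ¬ ∀ i j, ξ i ω * X i ω j = 0}) (by positivity) ?_
      (le_of_eq_of_le (ae_iff.1 h0) zero_le)
    intro ω hω
    have hω' : ∀ i j, ξ i ω * X i ω j = 0 := not_not.1 hω
    have h2 : multiplierConst q * (u * w + u ^ 2 * v) * L * normL P₀ q ξ₀ * √(N : ℝ)
            * √(t * Real.log d) * maxNormL2 P₀ X₀ = 0 := by
      calc _ = multiplierConst q * (u * w + u ^ 2 * v) * √(N : ℝ) * √(t * Real.log d) *
            (L * normL P₀ q ξ₀ * maxNormL2 P₀ X₀) := by ring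
        _ = 0 := by rw [h1, mul_zero]
    rw [Set.mem_ofPred_eq, h2]
    simp [mul_assoc, hω']
  rcases (maxNormL2_nonneg (P₀ := P₀) (X₀ := X₀)).eq_or_lt with hM | hM
  · refine hdeg ?_ (by rw [← hM, mul_zero])
    filter_upwards [S.ae_design_eq_zero H hM.symm] with ω hω
    simp [hω]
  rcases (normL_nonneg (P := P₀) (p := q) (Z := ξ₀)).eq_or_lt with hξ | hξ
  · refine hdeg ?_ (by rw [← hξ, mul_zero, zero_mul])
    filter_upwards [S.ae_noise_eq_zero H hξ.symm] with ω hω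
    simp [hω]
  have hL := H.pos_of_maxNormL2_pos hM
  set D := L * maxNormL2 P₀ X₀ with hD
  have hD0 : 0 < D := mul_pos hL hM
  have hX : AEMeasurable (fun ω => (X₀ ω, ξ₀ ω)) P₀ :=
    (S.copies ⟨0, by omega⟩).aemeasurable_snd
  have : IsProbabilityMeasure (P₀.map fun ω => (X₀ ω, ξ₀ ω)) := Measure.isProbabilityMeasure_map hX
  have hmx : ∀ j : Fin d, ∀ a : ℝ, 2 ≤ a → a ≤ 2 * p →
      ∫⁻ z, ENNReal.ofReal (|z.1 j / D| ^ a) ∂(P₀.map fun ω => (X₀ ω, ξ₀ ω)) ≤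
        ENNReal.ofReal (√a ^ a) := fun j a ha hat =>
    H.lintegral_design_le hX hM j ha (by linarith)
  have hmg := H.lintegral_noise_le hX hξ
  -- Here `t ≥ 4` enters: `p / 2 = t log d / 4 ≥ log d`.
  have hdp : (d : ℝ) ≤ Real.exp (p / 2) := by
    rw [← Real.log_le_iff_le_exp hd0]
    linarith
  have hnp : 2 * Real.log N ≤ p := by linarith [H.log_le]
  have hbad : ((Measure.pi fun _ : Fin N => signLaw).prod
      (Measure.pi fun _ : Fin N => P₀.map fun ω => (X₀ ω, ξ₀ ω)))
      {ω | ∃ j, multiplierConst q * (u * w + u ^ 2 * v) * √N * √p <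
        |∑ i, ω.1 i * ((ω.2 i).2 / normL P₀ q ξ₀ * ((ω.2 i).1 j / D))|} ≤
      ENNReal.ofReal (E₁ + 4 * E₂ + 3 * T + 2 * Real.exp (-(2 * v ^ 2 * p))) := by
    rcases lt_or_ge (N : ℝ) p with hpN | hpN
    -- For `p > N` the value `m` may exceed `p`, be negative, or be `0` by the division convention
    -- at `p = eN`; only `E₂ ≥ 0` is needed.
    · refine (measure_multiplier_gt_le_of_lt (P₀.map fun ω => (X₀ ω, ξ₀ ω)) (x := fun j z => z.1 j / D)
        (g := fun z => z.2 / normL P₀ q ξ₀) (fun j => by fun_prop) (by fun_prop) hN (by linarith)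
        hnp hdp hmx hmg hq hu hv hw hpN).trans (ENNReal.ofReal_le_ofReal ?_)
      linarith
    · have hp0 : 0 < p := by linarith
      have hmp : m ≤ p := by
        rw [hm]
        refine div_le_self hp0.le ?_
        -- For `p ≤ N` the logarithm `log (eN/p)` is at least one, hence `m ≤ p`.
        rw [Real.le_log_iff_exp_le (by positivity), le_div_iff₀ hp0]
        gcongr
      refine (measure_multiplier_gt_le_of_le (P₀.map fun ω => (X₀ ω, ξ₀ ω)) (x := fun j z => z.1 j / D)
        (g := fun z => z.2 / normL P₀ q ξ₀) (fun j => by fun_prop) (by fun_prop) hN (by linarith)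
        hnp hdp (by linarith) hmx hmg hq hu hv hw hpN hmp).trans (ENNReal.ofReal_le_ofReal ?_)
      linarith
  rw [← S.map_joint] at hbad
  refine one_sub_le_measureReal (by positivity) ?_
    ((Measure.le_map_apply S.aemeasurable_joint _).trans hbad)
  intro ω hω
  simp only [Set.mem_compl_iff, Set.mem_preimage, Set.mem_ofPred_eq, not_exists, not_lt] at hω ⊢
  have hξD : 0 < normL P₀ q ξ₀ * D := mul_pos hξ hD0
  have hpos : 0 ≤ multiplierConst q * (u * w + u ^ 2 * v) := by
    have := multiplierConst_pos q
    positivity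
  refine Real.iSup_le (fun j => ?_) ?_
  · have e1 : ∑ i, ε i ω * ξ i ω * X i ω j = normL P₀ q ξ₀ * D *
        ∑ i, ε i ω * (ξ i ω / normL P₀ q ξ₀ * (X i ω j / D)) := by
      rw [Finset.mul_sum]
      refine Finset.sum_congr rfl fun i _ => ?_
      field_simp
    rw [e1, abs_mul, abs_of_pos hξD]
    calc _ ≤ normL P₀ q ξ₀ * D * (multiplierConst q * (u * w + u ^ 2 * v) * √N * √p) :=
          mul_le_mul_of_nonneg_left (hω j) hξD.le
      _ ≤ normL P₀ q ξ₀ * D * (multiplierConst q * (u * w + u ^ 2 * v) * √N *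
            √(t * Real.log d)) := by
          refine mul_le_mul_of_nonneg_left (mul_le_mul_of_nonneg_left
            (Real.sqrt_le_sqrt (by linarith)) ?_) hξD.le
          positivity
      _ = _ := by
          rw [hD]
          ring
  · have : 0 ≤ normL P₀ q ξ₀ := hξ.le
    positivity

end

theorem theorem3p6 (a₀ a₁ κ : ℝ) (ha₀ : 0 < a₀) (ha₁ : 0 < a₁) (hκ : 0 < κ) :
    ∃ (c₀ c₁ c₂ : ℝ) (c₃ : ℝ → ℝ), 0 < c₀ ∧ 0 < c₁ ∧ 0 < c₂ ∧ (∀ q, 0 < c₃ q) ∧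
      ∀ {Ω₀ Ω : Type*} [MeasurableSpace Ω₀] [MeasurableSpace Ω]
        (P₀ : Measure Ω₀) (P : Measure Ω) [IsProbabilityMeasure P₀] [IsProbabilityMeasure P]
        (N d : ℕ) (t L q : ℝ) (X₀ : Ω₀ → Fin d → ℝ) (ξ₀ : Ω₀ → ℝ)
        (X : Fin N → Ω → Fin d → ℝ) (ξ ε : Fin N → Ω → ℝ),
        LimitedMoments P₀ a₀ a₁ κ N d t L q X₀ ξ₀ →
        SignedSample P₀ P X₀ ξ₀ X ξ ε →
        (Integrable (fun ω => ⨆ j : Fin d, |1 / √(N : ℝ) * ∑ i, ε i ω * X i ω j|) P ∧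
          ∫ ω, (⨆ j : Fin d, |1 / √(N : ℝ) * ∑ i, ε i ω * X i ω j|) ∂P
            ≤ c₀ * √(Real.log d) * L * maxNormL2 P₀ X₀) ∧
        ∀ u v w p m : ℝ, 2 < u → 0 < v → 2 ≤ w →
          p = t * Real.log d / 2 → m = p / Real.log (Real.exp 1 * N / p) →
          1 - Real.exp (-p / 2) / u ^ (2 * p) - 4 * Real.exp (-p / 2) / u ^ (c₁ * m)
              - c₂ * Real.log N ^ q / (w ^ q * (N : ℝ) ^ (q / 2 - 1))
              - 2 * Real.exp (-(v ^ 2 * t * Real.log d))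
            ≤ P.real {ω | (⨆ j : Fin d, |∑ i, ε i ω * ξ i ω * X i ω j|)
                ≤ c₃ q * (u * w + u ^ 2 * v) * L * normL P₀ q ξ₀ * √(N : ℝ)
                  * √(t * Real.log d) * maxNormL2 P₀ X₀} := by
  refine ⟨4 + 4 * Real.exp 1 ^ 3 * (1 + κ), 1, 3, multiplierConst, by positivity, one_pos,
    by norm_num, multiplierConst_pos, ?_⟩
  intro Ω₀ Ω _ _ P₀ P _ _ N d t L q X₀ ξ₀ X ξ ε H S
  exact ⟨S.integral_iSup_sign_sum_le H hκ, fun _ _ _ _ _ hu hv hw hp hm =>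
    S.le_measureReal_multiplier H hu hv hw hp hm⟩
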